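/- All graphs are finite and simple. A signed graph $(G,\sigma)$ is a graph $G$ with a signature $\sigma:E(G)\to\{+,-\}$. Switching at a vertex $v$ negates the signs of all edges incident with $v$; two signatures on $G$ are switching equivalent if one is obtained from the other by a sequence of vertex switchings, and $(G,\sigma)$ is switching equivalent to $(H,\tau)$ if, for some isomorphism $G\cong H$, $\sigma$ is switching equivalent to the signature of $G$ corresponding to $\tau$. A set $X\subseteq V(G)$ is balanced if the restriction of $\sigma$ to $G[X]$ is switching equivalent to the all-positive signature of $G[X]$. For integers $1\le q\le p$, a balanced $(p,q)$-coloring of $(G,\sigma)$ assigns to each vertex a set of exactly $q$ colors from $\{1,\dots,p\}$ such that for every color $i$ the set of vertices that are assigned $i$ is balanced. The fractional balanced chromatic number $\chi_{fb}(G,\sigma)$ is the infimum of $p/q$ over all $1\le q\le p$ for which $(G,\sigma)$ admits a balanced $(p,q)$-coloring. Let $(K_4,-)$ denote $K_4$ with all edges negative. **Theorem 1.4.** Let $(G,\sigma)$ be a signed graph in which every vertex has degree at most $3$ and no connected component of which is switching equivalent to $(K_4,-)$ (for connected $G$: $(G,\sigma)$ is not switching equivalent to $(K_4,-)$). Then $(G,\sigma)$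 admits a balanced $(5,3)$-coloring; hence $\chi_{fb}(G,\sigma)\le 5/3$. -/

import Mathlib

namespace SignedGraph

/-- A signature on `G`: a sign `1` or `-1` on each edge. A signed graph is a pair `(G, σ)` with
`G` a simple graph and `σ : Signature G`. -/
abbrev Signature {V : Type*} (G : SimpleGraph V) : Type _ := G.edgeSet → ℤˣ

open scoped Classical in
/-- Vertex switching at `v`: the signs of the edges at `v` are negated. -/
noncomputable def switchAt {V : Type*} {G : SimpleGraph V} (v : V) (σ : Signature G) :
    Signature G :=
  fun e => if v ∈ (e : Sym2 V) then -σ e else σ e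

/-- Two signatures on the same graph are switching equivalent if the second is obtained from the
first by a (finite) sequence of vertex switchings. -/
def SwitchingEquiv {V : Type*} {G : SimpleGraph V} (σ τ : Signature G) : Prop :=
  Relation.ReflTransGen (fun σ₁ σ₂ => ∃ v : V, σ₂ = switchAt v σ₁) σ τ

/-- `(G, σ)` is balanced if it is switching equivalent to `(G, +)`. -/
def IsBalanced {V : Type*} {G : SimpleGraph V} (σ : Signature G) : Prop :=
  SwitchingEquiv σ (fun _ => 1)

/-- The restriction of a signature to the induced subgraph `G[X]`. -/
def Signature.restrict {V : Type*} {G : SimpleGraph V} (σ : Signature G) (X : Set V) :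
    Signature (G.induce X) :=
  fun e => σ ((SimpleGraph.Embedding.induce X).toHom.mapEdgeSet e)

/-- A set `X` of vertices is balanced if the signed graph it induces is balanced. -/
def IsBalancedSet {V : Type*} {G : SimpleGraph V} (σ : Signature G) (X : Set V) : Prop :=
  IsBalanced (σ.restrict X)

/-- `(G, σ)` is switching equivalent to (a copy of) `(H, τ)`: for some isomorphism between the
underlying graphs, `σ` is switching equivalent to the signature transported from `τ`. -/
def SwitchingIsomorphic {V W : Type*} {G : SimpleGraph V} {H : SimpleGraph W}
    (σ : Signature G) (τ : Signature H) : Prop :=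
  ∃ φ : G ≃g H, SwitchingEquiv σ (fun e => τ (φ.mapEdgeSet e))

/-- The signature of `(K₄, -)`, the complete graph on four vertices with all edges negative. -/
def negK4 : Signature (⊤ : SimpleGraph (Fin 4)) := fun _ => -1

/-- `f` is a balanced `(p, φ)`-coloring of `(G, σ)`: each vertex `v` receives a set of `φ v`
colors out of `p` colors, and every color class is a balanced set. -/
def IsBalancedColoring {V : Type*} {G : SimpleGraph V} (σ : Signature G) (p : ℕ) (φ : V → ℕ)
    (f : V → Finset (Fin p)) : Prop :=
  (∀ v, (f v).card = φ v) ∧ ∀ i : Fin p, IsBalancedSet σ {v | i ∈ f v}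

/-- `(G, σ)` admits a balanced `(p, q)`-coloring. -/
def AdmitsColoring {V : Type*} {G : SimpleGraph V} (σ : Signature G) (p q : ℕ) : Prop :=
  ∃ f : V → Finset (Fin p), IsBalancedColoring σ p (fun _ => q) f

/-- The fractional balanced chromatic number: the infimum of `p / q` over all `1 ≤ q ≤ p` such
that a balanced `(p, q)`-coloring exists. -/
noncomputable def fractionalBalancedChromaticNumber {V : Type*} {G : SimpleGraph V}
    (σ : Signature G) : ℝ :=
  sInf {x : ℝ | ∃ p q : ℕ, 1 ≤ q ∧ q ≤ p ∧ AdmitsColoring σ p q ∧ x = (p : ℝ) / (q : ℝ)}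

end SignedGraph

/-! The signature matters only on copies of K₄. A subcubic graph without K₄ has, whatever its signs,
a coloring with three of five colors per vertex in which every color class induces a forest; forests
are balanced under every signature. A K₄ in a subcubic graph is a whole component. Unless it is
switching equivalent to (K₄,-), it has two positive triangles, which share an edge, and an explicit
coloring uses just these two triangles and smaller sets.

The forest coloring (`exists_isForestColoring_of_isK4FreeOn`) is an induction on the number of
vertices, with the graph allowed to vary since some reductions add edges. A vertex of degree at most
two is deleted and reinserted, after exchanging one color at a neighbor if necessary
(`extend_of_two_neighbors`). In a cubic graph, a diamond is deleted and its four vertices are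
colored directly (`extend_diamond`). Otherwise, a triangle is deleted and two of its outer neighbors
are joined, so that in a color class two triangle vertices may subdivide the new edge
(`extend_triangle`); if no two outer neighbors can be joined, the component is a prism.

In a cubic triangle-free graph, adjacent vertices v, z are deleted, and the two other neighbors of
each are joined. Either this creates a K₄ and the component was K₃,₃, or in the resulting coloring
each color may be given to v, and each to z, separately. Since 3 + 3 = 5 + 1, v and z need only one
common color; a count of the colors around the neighbors of v finds one, possibly after an exchange
(`extend_adjacent_pair`). -/

namespace SignedGraph

/-! ### Induced forests, expressed through signatures. -/

variable {V : Type*} {G : SimpleGraph V} {F : Set V}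

/-- Every signature is balanced on the subgraph induced by `F`; equivalently, `F` induces a
forest. -/
def IsForestOn (G : SimpleGraph V) (F : Set V) : Prop :=
  ∀ σ : V → V → ℤˣ, (∀ u v, σ u v = σ v u) →
    ∃ s : V → ℤˣ, ∀ u ∈ F, ∀ v ∈ F, G.Adj u v → σ u v = s u * s v

theorem IsForestOn.mono {F' : Set V} (h : IsForestOn G F) (hF : F' ⊆ F) : IsForestOn G F' := by
  intro σ hσ
  obtain ⟨s, hs⟩ := h σ hσ
  exact ⟨s, fun u hu v hv => hs u (hF hu) v (hF hv)⟩

theorem IsForestOn.mono_graph {H : SimpleGraph V} (h : IsForestOn H F) (hG : G ≤ H) :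
    IsForestOn G F := by
  intro σ hσ
  obtain ⟨s, hs⟩ := h σ hσ
  exact ⟨s, fun u hu v hv huv => hs u hu v hv (hG huv)⟩

/-- Adding a vertex with at most one neighbour preserves forests. -/
theorem IsForestOn.insert_leaf (h : IsForestOn G F) (v w : V)
    (hv : ∀ u ∈ F, G.Adj v u → u = w) : IsForestOn G (insert v F) := by
  classical
  by_cases hvF : v ∈ F
  · rwa [Set.insert_eq_of_mem hvF]
  intro σ hσ
  obtain ⟨s, hs⟩ := h σ hσ
  have key : ∀ u ∈ F, G.Adj v u →
      σ v u = Function.update s v (σ v w * s w) v * Function.update s v (σ v w * s w) u := by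
    intro u hu huv
    have huw := hv u hu huv
    subst huw
    have : u ≠ v := fun h => hvF (h ▸ hu)
    simp [Function.update_of_ne this, mul_assoc]
  refine ⟨Function.update s v (σ v w * s w), ?_⟩
  rintro a (rfl | ha) b (rfl | hb) hab
  · exact absurd hab (G.irrefl)
  · exact key b hb hab
  · rw [hσ, key a ha hab.symm, mul_comm]
  · have h1 : a ≠ v := fun h => hvF (h ▸ ha)
    have h2 : b ≠ v := fun h => hvF (h ▸ hb)
    rw [Function.update_of_ne h1, Function.update_of_ne h2]
    exact hs a ha b hb hab

theorem IsForestOn.insert_isolated (h : IsForestOn G F) (v : V)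
    (hv : ∀ u ∈ F, ¬ G.Adj v u) : IsForestOn G (insert v F) :=
  h.insert_leaf v v fun u hu huv => absurd huv (hv u hu)

/-- The sign of the added edge is free, so giving it the value ε prescribes the product of the
potentials at its ends. This is how a path replacing the edge can be given any signs. -/
theorem exists_potential_of_sup_edge {x y : V} (hne : x ≠ y) (hxy : ¬ G.Adj x y)
    (h : IsForestOn (G ⊔ SimpleGraph.edge x y) F) (hx : x ∈ F) (hy : y ∈ F) (ε : ℤˣ)
    {σ : V → V → ℤˣ} (hσ : ∀ u v, σ u v = σ v u) :
    ∃ s : V → ℤˣ, s x * s y = ε ∧ ∀ u ∈ F, ∀ v ∈ F, G.Adj u v → σ u v = s u * s v := by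
  classical
  obtain ⟨s, hs⟩ := h (fun a b => if a = x ∧ b = y ∨ a = y ∧ b = x then ε else σ a b)
    (by intro u v; simp only [hσ u v]; congr 1; grind)
  refine ⟨s, ?_, fun u hu v hv huv => ?_⟩
  · have := hs x hx y hy (by simp [SimpleGraph.edge_adj, hne])
    simpa using this.symm
  · have := hs u hu v hv (by simp [huv])
    rwa [if_neg] at this
    rintro (⟨rfl, rfl⟩ | ⟨rfl, rfl⟩)
    · exact hxy huv
    · exact hxy huv.symm

/-- Replacing an edge `xy` by a path `x v y` preserves forests. -/
theorem IsForestOn.subdivide {x y : V} (hne : x ≠ y) (hxy : ¬ G.Adj x y)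
    (h : IsForestOn (G ⊔ SimpleGraph.edge x y) F)
    (v : V) (hv : ∀ u ∈ F, G.Adj v u → u = x ∨ u = y) : IsForestOn G (insert v F) := by
  classical
  have hG : IsForestOn G F := h.mono_graph le_sup_left
  by_cases hvF : v ∈ F
  · rwa [Set.insert_eq_of_mem hvF]
  by_cases hx : x ∈ F
  swap
  · exact hG.insert_leaf v y fun u hu huv => (hv u hu huv).resolve_left fun h => hx (h ▸ hu)
  by_cases hy : y ∈ F
  swap
  · exact hG.insert_leaf v x fun u hu huv => (hv u hu huv).resolve_right fun h => hy (h ▸ hu)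
  intro σ hσ
  -- The prescribed value is the sign of the path x v y, so the values that x and y force at v
  -- coincide.
  obtain ⟨s, hε, hs⟩ := exists_potential_of_sup_edge hne hxy h hx hy (σ v x * σ v y) hσ
  have key : ∀ u ∈ F, G.Adj v u → σ v u = (σ v x * s x) * s u := by
    intro u hu huv
    rcases hv u hu huv with rfl | rfl
    · simp [mul_assoc]
    · rw [mul_assoc, hε, ← mul_assoc]
      simp
  have hne' : ∀ u ∈ F, u ≠ v := fun u hu h => hvF (h ▸ hu)
  refine ⟨Function.update s v (σ v x * s x), ?_⟩
  rintro a (rfl | ha) b (rfl | hb) hab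
  · exact absurd hab (G.irrefl)
  · rw [Function.update_self, Function.update_of_ne (hne' b hb)]
    exact key b hb hab
  · rw [hσ, Function.update_self, Function.update_of_ne (hne' a ha), mul_comm (s a)]
    exact key a ha hab.symm
  · rw [Function.update_of_ne (hne' a ha), Function.update_of_ne (hne' b hb)]
    exact hs a ha b hb hab

/-- Replacing an edge `xy` by a path `x a b y` preserves forests. -/
theorem IsForestOn.subdivide_two {x y : V} (hne : x ≠ y) (hxy : ¬ G.Adj x y)
    (h : IsForestOn (G ⊔ SimpleGraph.edge x y) F) {a b : V} (hab : a ≠ b)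
    (haF : a ∉ F) (hbF : b ∉ F)
    (ha : ∀ u ∈ F, G.Adj a u → u = x) (hb : ∀ u ∈ F, G.Adj b u → u = y) :
    IsForestOn G (insert a (insert b F)) := by
  classical
  have hG : IsForestOn G F := h.mono_graph le_sup_left
  by_cases hx : x ∈ F
  swap
  · refine (hG.insert_leaf b y hb).insert_leaf a b ?_
    rintro u (rfl | hu) hau
    · rfl
    · exact absurd hu ((ha u hu hau) ▸ hx)
  by_cases hy : y ∈ F
  swap
  · rw [Set.insert_comm]
    refine (hG.insert_leaf a x ha).insert_leaf b a ?_
    rintro u (rfl | hu) hbu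
    · rfl
    · exact absurd hu ((hb u hu hbu) ▸ hy)
  intro σ hσ
  obtain ⟨s, hε, hs⟩ :=
    exists_potential_of_sup_edge hne hxy h hx hy (σ a x * σ a b * σ b y) hσ
  have hna : ∀ u ∈ F, u ≠ a := fun u hu h => haF (h ▸ hu)
  have hnb : ∀ u ∈ F, u ≠ b := fun u hu h => hbF (h ▸ hu)
  set s' := Function.update (Function.update s b (σ b y * s y)) a (σ a x * s x) with hs'
  have hsa : s' a = σ a x * s x := by simp [hs']
  have hsb : s' b = σ b y * s y := by simp [hs', Function.update_of_ne hab.symm]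
  have hsF : ∀ u ∈ F, s' u = s u := fun u hu => by
    simp [hs', Function.update_of_ne (hna u hu), Function.update_of_ne (hnb u hu)]
  have kab : σ a b = s' a * s' b := by
    rw [hsa, hsb, mul_mul_mul_comm, hε]
    rcases Int.units_eq_one_or (σ a x) with h1 | h1 <;>
      rcases Int.units_eq_one_or (σ b y) with h2 | h2 <;> simp [h1, h2]
  have ka : ∀ u ∈ F, G.Adj a u → σ a u = s' a * s' u := by
    intro u hu hau
    rw [hsF u hu, hsa, ha u hu hau]
    simp [mul_assoc]
  have kb : ∀ u ∈ F, G.Adj b u → σ b u = s' b * s' u := by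
    intro u hu hbu
    rw [hsF u hu, hsb, hb u hu hbu]
    simp [mul_assoc]
  refine ⟨s', ?_⟩
  rintro p (rfl | rfl | hp) q (rfl | rfl | hq) hpq
  · exact absurd hpq (G.irrefl)
  · exact kab
  · exact ka q hq hpq
  · rw [hσ, mul_comm]
    exact kab
  · exact absurd hpq (G.irrefl)
  · exact kb q hq hpq
  · rw [hσ, mul_comm]
    exact ka p hp hpq.symm
  · rw [hσ, mul_comm]
    exact kb p hp hpq.symm
  · rw [hsF p hp, hsF q hq]
    exact hs p hp q hq hpq

/-! ### Forest colorings. -/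

/-- Every vertex of `U` receives three of five colors, other vertices receive none, and each color
class induces a forest. -/
structure IsForestColoring (G : SimpleGraph V) (U : Finset V) (f : V → Finset (Fin 5)) :
    Prop where
  card : ∀ v ∈ U, (f v).card = 3
  empty : ∀ v ∉ U, f v = ∅
  forest : ∀ i, IsForestOn G {v | i ∈ f v}

variable {U : Finset V} {f : V → Finset (Fin 5)}

theorem IsForestColoring.mem (h : IsForestColoring G U f) {v : V} {i : Fin 5} (hi : i ∈ f v) :
    v ∈ U := by
  by_contra hv
  simp [h.empty v hv] at hi

theorem IsForestColoring.card_le (h : IsForestColoring G U f) (v : V) : (f v).card ≤ 3 := by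
  by_cases hv : v ∈ U
  · exact (h.card v hv).le
  · simp [h.empty v hv]

/-- Surplus colors can be discarded, because subsets of forests are forests. -/
theorem exists_isForestColoring (h3 : ∀ v ∈ U, 3 ≤ (f v).card)
    (hf : ∀ i, IsForestOn G {v | v ∈ U ∧ i ∈ f v}) : ∃ g, IsForestColoring G U g := by
  classical
  choose! g hg hg3 using fun v hv => Finset.exists_subset_card_eq (h3 v hv)
  refine ⟨fun v => if v ∈ U then g v else ∅, fun v hv => by simp [hv, hg3],
    fun v hv => by simp [hv], fun i => (hf i).mono fun v hv => ?_⟩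
  by_cases hvU : v ∈ U
  · simp only [hvU, if_true, Set.mem_ofPred_eq] at hv
    exact ⟨hvU, hg v hvU hv⟩
  · simp [hvU] at hv

end SignedGraph

/-! ### Reinserting a vertex of degree at most two. -/

namespace SignedGraph

variable {V : Type*} {G : SimpleGraph V} {U : Finset V} {f : V → Finset (Fin 5)}

/-- A coloring extends to a new vertex of degree at most two, after recoloring one neighbour. -/
theorem IsForestColoring.extend_of_two_neighbors [DecidableEq V] {v x y p q : V}
    (hf : IsForestColoring G (U.erase v) f)
    (hv : ∀ w ∈ U, G.Adj v w → w = x ∨ w = y)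
    (hx : ∀ w ∈ U, G.Adj x w → w = v ∨ w = p ∨ w = q) : ∃ g, IsForestColoring G U g := by
  have hmem : ∀ {w i}, i ∈ f w → w ∈ U ∧ w ≠ v := fun h => by
    have := hf.mem h
    simp only [Finset.mem_erase] at this
    exact ⟨this.2, this.1⟩
  have hfv : f v = ∅ := hf.empty v (by simp)
  -- it suffices to find three colors available at `v`
  have ext1 : ∀ C : Finset (Fin 5), 3 ≤ C.card →
      (∀ i ∈ C, IsForestOn G (insert v {w | i ∈ f w})) → ∃ g, IsForestColoring G U g := by
    intro C hC hCf
    refine exists_isForestColoring (f := Function.update f v C) ?_ ?_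
    · intro w hw
      by_cases hwv : w = v
      · simpa [hwv] using hC
      · rw [Function.update_of_ne hwv, hf.card w (by simp [hw, hwv])]
    · intro i
      by_cases hi : i ∈ C
      · refine (hCf i hi).mono fun w hw => ?_
        by_cases hwv : w = v
        · simp [hwv]
        · simp [Function.update_of_ne hwv] at hw
          simp [hw]
      · refine (hf.forest i).mono fun w hw => ?_
        by_cases hwv : w = v
        · simp [hwv, hi] at hw
        · simp [Function.update_of_ne hwv] at hw
          simp [hw]
  have avail : ∀ i, i ∉ f x ∩ f y → IsForestOn G (insert v {w | i ∈ f w}) := by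
    intro i hi
    by_cases hix : i ∈ f x
    · refine (hf.forest i).insert_leaf v x fun u hu hvu => ?_
      rcases hv u (hmem hu).1 hvu with h | rfl
      · exact h
      · exact absurd (Finset.mem_inter.2 ⟨hix, hu⟩) hi
    · refine (hf.forest i).insert_leaf v y fun u hu hvu => ?_
      rcases hv u (hmem hu).1 hvu with rfl | h
      · exact absurd hu hix
      · exact h
  -- A color missing at x or at y makes v a leaf of its class. Three such colors exist unless x and
  -- y carry the same three colors.
  by_cases h2 : (f x ∩ f y).card ≤ 2
  · refine ext1 (f x ∩ f y)ᶜ ?_ fun i hi => avail i (Finset.mem_compl.1 hi)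
    rw [Finset.card_compl, Fintype.card_fin]
    omega
  have hcx := hf.card_le x
  have hcy := hf.card_le y
  have hIx : f x ∩ f y = f x := Finset.eq_of_subset_of_card_le Finset.inter_subset_left (by omega)
  have hIy : f x ∩ f y = f y := Finset.eq_of_subset_of_card_le Finset.inter_subset_right (by omega)
  have hxy : f y = f x := hIy.symm.trans hIx
  have hcard : (f x).card = 3 := by rw [hIx] at h2; omega
  have hccard : (f x)ᶜ.card = 2 := by simp [Finset.card_compl, hcard]
  -- The two colors outside `f x` are free at v, so one more color suffices.
  by_cases hblock : ∃ i ∈ f x, IsForestOn G (insert v {w | i ∈ f w})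
  · obtain ⟨i, hi, hiF⟩ := hblock
    refine ext1 (insert i (f x)ᶜ) ?_ fun j hj => ?_
    · rw [Finset.card_insert_of_notMem (by simpa using hi), hccard]
    · rcases Finset.mem_insert.1 hj with rfl | hj
      · exact hiF
      · exact avail j (by simp at hj; simp [hj])
  push Not at hblock
  have hne : x ≠ y := by
    rintro rfl
    obtain ⟨i, hi⟩ : (f x).Nonempty := Finset.card_pos.1 (by omega)
    refine hblock i hi ((hf.forest i).insert_leaf v x fun u hu hvu => ?_)
    simpa using hv u (hmem hu).1 hvu
  -- If a color of x were absent from p and q, one could take x out of its class, hang v on y and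
  -- then x on v, so the color would be free at v.
  have hcover : f x ⊆ f p ∪ f q := by
    intro i hi
    by_contra hpq
    simp only [Finset.mem_union, not_or] at hpq
    have h1 : IsForestOn G (insert v ({w | i ∈ f w} \ {x})) := by
      refine ((hf.forest i).mono Set.sdiff_subset).insert_leaf v y ?_
      rintro u ⟨hu, hux⟩ hvu
      exact (hv u (hmem hu).1 hvu).resolve_left hux
    have h2 : IsForestOn G (insert x (insert v ({w | i ∈ f w} \ {x}))) := by
      refine h1.insert_leaf x v ?_
      rintro u (rfl | ⟨hu, hux⟩) hxu
      · rfl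
      · rcases hx u (hmem hu).1 hxu with h | rfl | rfl
        · exact h
        · exact absurd hu hpq.1
        · exact absurd hu hpq.2
    refine hblock i hi (h2.mono ?_)
    intro u hu
    by_cases hux : u = x
    · simp [hux]
    · simp only [Set.mem_insert_iff, Set.mem_sdiff, Set.mem_singleton_iff, hux] at hu ⊢
      tauto
  -- If p and q both carried the two colors outside `f x`, each would have at most one color left,
  -- too few to cover the three colors of x.
  obtain ⟨j, hj, hjpq⟩ : ∃ j ∈ (f x)ᶜ, j ∉ f p ∩ f q := by
    by_contra! hcon
    have hp : (f x)ᶜ ⊆ f p := fun j hj => (Finset.mem_inter.1 (hcon j hj)).1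
    have hq : (f x)ᶜ ⊆ f q := fun j hj => (Finset.mem_inter.1 (hcon j hj)).2
    have hsub : f x ⊆ (f p \ (f x)ᶜ) ∪ (f q \ (f x)ᶜ) := fun i hi => by
      have := hcover hi
      simp only [Finset.mem_union, Finset.mem_sdiff, Finset.mem_compl, not_not, hi] at this ⊢
      tauto
    have h1 := Finset.card_le_card hsub
    have h2 := Finset.card_union_le (f p \ (f x)ᶜ) (f q \ (f x)ᶜ)
    rw [Finset.card_sdiff_of_subset hp, Finset.card_sdiff_of_subset hq] at h2
    have := hf.card_le p
    have := hf.card_le q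
    omega
  have hjx : j ∉ f x := by simpa using hj
  obtain ⟨i, hi⟩ : (f x).Nonempty := Finset.card_pos.1 (by omega)
  have hij : i ≠ j := fun h => hjx (h ▸ hi)
  have hxv : x ≠ v := (hmem hi).2
  -- The vertex x trades i for j, and v takes i together with the two colors outside the old `f x`.
  -- In class i, v hangs on y alone; in class j, x hangs on at most one of p, q, and v hangs on x
  -- because y lacks j.
  refine exists_isForestColoring (f := Function.update (Function.update f x
    (insert j ((f x).erase i))) v (insert i (f x)ᶜ)) ?_ ?_
  · intro w hw
    by_cases hwv : w = v
    · subst hwv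
      rw [Function.update_self, Finset.card_insert_of_notMem (by simpa using hi), hccard]
    · rw [Function.update_of_ne hwv]
      by_cases hwx : w = x
      · subst hwx
        rw [Function.update_self, Finset.card_insert_of_notMem (by simp [hjx]),
          Finset.card_erase_of_mem hi, hcard]
      · rw [Function.update_of_ne hwx, hf.card w (by simp [hw, hwv])]
  · intro k
    have hclass : ∀ w, k ∈ Function.update (Function.update f x
        (insert j ((f x).erase i))) v (insert i (f x)ᶜ) w →
        (w = v ∧ (k = i ∨ k ∉ f x)) ∨ (w = x ∧ (k = j ∨ k ≠ i ∧ k ∈ f x)) ∨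
          (w ≠ x ∧ k ∈ f w) := by
      intro w hw
      by_cases hwv : w = v
      · subst hwv
        exact .inl ⟨rfl, by simpa using hw⟩
      · rw [Function.update_of_ne hwv] at hw
        by_cases hwx : w = x
        · subst hwx
          exact .inr (.inl ⟨rfl, by simpa using hw⟩)
        · rw [Function.update_of_ne hwx] at hw
          exact .inr (.inr ⟨hwx, hw⟩)
    by_cases hki : k = i
    · subst hki
      have h1 : IsForestOn G (insert v ({w | k ∈ f w} \ {x})) := by
        refine ((hf.forest k).mono Set.sdiff_subset).insert_leaf v y ?_
        rintro u ⟨hu, hux⟩ hvu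
        exact (hv u (hmem hu).1 hvu).resolve_left hux
      refine h1.mono fun w hw => ?_
      have := hclass w hw.2
      simp only [Set.mem_insert_iff, Set.mem_sdiff, Set.mem_singleton_iff, Set.mem_ofPred_eq]
      grind
    by_cases hkx : k ∈ f x
    · refine (hf.forest k).mono fun w hw => ?_
      have := hclass w hw.2
      simp only [Set.mem_ofPred_eq]
      grind
    by_cases hkj : k = j
    · subst hkj
      have h1 : IsForestOn G (insert x {w | k ∈ f w}) := by
        by_cases hkp : k ∈ f p
        · refine (hf.forest k).insert_leaf x p fun u hu hxu => ?_
          have := hx u (hmem hu).1 hxu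
          have := (hmem hu).2
          simp only [Set.mem_ofPred_eq] at hu
          grind
        · refine (hf.forest k).insert_leaf x q fun u hu hxu => ?_
          have := hx u (hmem hu).1 hxu
          have := (hmem hu).2
          simp only [Set.mem_ofPred_eq] at hu
          grind
      have h2 := h1.insert_leaf v x (by
        rintro u (rfl | hu) hvu
        · rfl
        · refine (hv u (hmem hu).1 hvu).resolve_right ?_
          rintro rfl
          exact hkx (hxy ▸ hu))
      refine h2.mono fun w hw => ?_
      have := hclass w hw.2
      simp only [Set.mem_insert_iff, Set.mem_ofPred_eq]
      grind
    · refine (avail k (by simp [hkx])).mono fun w hw => ?_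
      have := hclass w hw.2
      simp only [Set.mem_insert_iff, Set.mem_ofPred_eq]
      grind

end SignedGraph

/-! ### Diamonds, triangles, prisms and K₃,₃. -/

namespace SignedGraph

variable {V : Type*} {G H : SimpleGraph V} {U S : Finset V} {f : V → Finset (Fin 5)}

/-- Each new class need only lie inside some forest of `G`. The old coloring may belong to another
graph `H`, for instance one with an added edge. -/
theorem IsForestColoring.extend_sdiff [DecidableEq V] (hf : IsForestColoring H (U \ S) f)
    (g : V → Finset (Fin 5)) (hg : ∀ v ∈ S, 3 ≤ (g v).card)
    (hF : ∀ i, ∃ F, IsForestOn G F ∧ (∀ w ∈ S, i ∈ g w → w ∈ F) ∧ ∀ w, i ∈ f w → w ∈ F) :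
    ∃ g, IsForestColoring G U g := by
  refine exists_isForestColoring (f := fun w => if w ∈ S then g w else f w) ?_ ?_
  · intro w hw
    by_cases hwS : w ∈ S
    · simpa [hwS] using hg w hwS
    · simp [hwS, hf.card w (by simp [hw, hwS])]
  · intro i
    obtain ⟨F, hF, hgF, hfF⟩ := hF i
    refine hF.mono fun w hw => ?_
    by_cases hwS : w ∈ S
    · simp only [hwS, if_true, Set.mem_ofPred_eq] at hw
      exact hgF w hwS hw.2
    · simp only [hwS, if_false, Set.mem_ofPred_eq] at hw
      exact hfF w hw.2

/-- Two colors `c₁`, `c₂` are absent from a'. In these classes the path a c d is attached to the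
rest only through d. The other three classes gain ab, bd and bc respectively, each attached to the
outside by at most one edge. -/
theorem IsForestColoring.extend_diamond [DecidableEq V] {a b c d a' d' : V}
    (hf : IsForestColoring G (U \ {a, b, c, d}) f)
    (hab : a ≠ b) (hac : a ≠ c) (had : a ≠ d) (hbc : b ≠ c) (hbd : b ≠ d) (hcd : c ≠ d)
    (had' : ¬ G.Adj a d)
    (ha : ∀ w ∈ U, G.Adj a w → w = b ∨ w = c ∨ w = a')
    (hb : ∀ w ∈ U, G.Adj b w → w = a ∨ w = c ∨ w = d)
    (hc : ∀ w ∈ U, G.Adj c w → w = a ∨ w = b ∨ w = d)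
    (hd : ∀ w ∈ U, G.Adj d w → w = b ∨ w = c ∨ w = d') : ∃ g, IsForestColoring G U g := by
  have hmem : ∀ {w i}, i ∈ f w → w ∈ U ∧ w ≠ a ∧ w ≠ b ∧ w ≠ c ∧ w ≠ d := fun h => by
    simpa [not_or] using hf.mem h
  -- The set `f a'` is empty if a' is outside the colored set, so it is first enlarged to three
  -- colors.
  obtain ⟨T, hT, hT3⟩ := Finset.exists_superset_card_eq (hf.card_le a') (by simp)
  obtain ⟨c₃, c₄, c₅, h34, h35, h45, rfl⟩ := Finset.card_eq_three.1 hT3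
  obtain ⟨c₁, c₂, h12, hcompl⟩ := Finset.card_eq_two.1
    (show ({c₃, c₄, c₅} : Finset (Fin 5))ᶜ.card = 2 by rw [Finset.card_compl, hT3]; rfl)
  have hpart : ∀ i, i = c₁ ∨ i = c₂ ∨ i = c₃ ∨ i = c₄ ∨ i = c₅ := by
    intro i
    have := Finset.ext_iff.1 hcompl i
    simp only [Finset.mem_compl, Finset.mem_insert, Finset.mem_singleton] at this
    tauto
  have hc1 : c₁ ∉ ({c₃, c₄, c₅} : Finset (Fin 5)) := by
    rw [← Finset.mem_compl, hcompl]; simp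
  have hc2 : c₂ ∉ ({c₃, c₄, c₅} : Finset (Fin 5)) := by
    rw [← Finset.mem_compl, hcompl]; simp
  have h1a : c₁ ∉ f a' := fun h => hc1 (hT h)
  have h2a : c₂ ∉ f a' := fun h => hc2 (hT h)
  simp only [Finset.mem_insert, Finset.mem_singleton, not_or] at hc1 hc2
  refine hf.extend_sdiff (fun w => if w = a then {c₁, c₂, c₃} else if w = b then {c₃, c₄, c₅} else
    if w = c then {c₁, c₂, c₅} else {c₁, c₂, c₄}) ?_ ?_
  · intro v hv
    simp only [Finset.mem_insert, Finset.mem_singleton] at hv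
    rcases hv with rfl | rfl | rfl | rfl <;> grind
  intro i
  have hFd : ∀ i, IsForestOn G (insert d {w | i ∈ f w}) := fun i =>
    (hf.forest i).insert_leaf d d' fun u hu hdu => by
      have := hd u (hmem hu).1 hdu
      have := hmem hu
      grind
  have hFa : ∀ i, IsForestOn G (insert a {w | i ∈ f w}) := fun i =>
    (hf.forest i).insert_leaf a a' fun u hu hau => by
      have := ha u (hmem hu).1 hau
      have := hmem hu
      grind
  have hF12 : ∀ i, i ∉ f a' → IsForestOn G (insert a (insert c (insert d {w | i ∈ f w}))) := by
    intro i hi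
    refine ((hFd i).insert_leaf c d ?_).insert_leaf a c ?_
    · rintro u (rfl | hu) hcu
      · rfl
      · have := hc u (hmem hu).1 hcu
        have := hmem hu
        grind
    · rintro u (rfl | rfl | hu) hau
      · rfl
      · exact absurd hau had'
      · have := ha u (hmem hu).1 hau
        have := hmem hu
        simp only [Set.mem_ofPred_eq] at hu
        grind
  have hF3 : ∀ i, IsForestOn G (insert b (insert a {w | i ∈ f w})) := by
    refine fun i => (hFa i).insert_leaf b a ?_
    rintro u (rfl | hu) hbu
    · rfl
    · have := hb u (hmem hu).1 hbu
      have := hmem hu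
      grind
  have hF4 : ∀ i, IsForestOn G (insert b (insert d {w | i ∈ f w})) := by
    refine fun i => (hFd i).insert_leaf b d ?_
    rintro u (rfl | hu) hbu
    · rfl
    · have := hb u (hmem hu).1 hbu
      have := hmem hu
      grind
  have hF5 : ∀ i, IsForestOn G (insert b (insert c {w | i ∈ f w})) := by
    refine fun i => ((hf.forest i).insert_isolated c ?_).insert_leaf b c ?_
    · intro u hu hcu
      have := hc u (hmem hu).1 hcu
      have := hmem hu
      grind
    · rintro u (rfl | hu) hbu
      · rfl
      · have := hb u (hmem hu).1 hbu
        have := hmem hu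
        grind
  rcases hpart i with rfl | rfl | rfl | rfl | rfl
  · refine ⟨_, hF12 i h1a, ?_, ?_⟩ <;>
      simp only [Set.mem_insert_iff, Set.mem_ofPred_eq, Finset.mem_insert, Finset.mem_singleton] <;>
      grind
  · refine ⟨_, hF12 i h2a, ?_, ?_⟩ <;>
      simp only [Set.mem_insert_iff, Set.mem_ofPred_eq, Finset.mem_insert, Finset.mem_singleton] <;>
      grind
  · refine ⟨_, hF3 i, ?_, ?_⟩ <;>
      simp only [Set.mem_insert_iff, Set.mem_ofPred_eq, Finset.mem_insert, Finset.mem_singleton] <;>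
      grind
  · refine ⟨_, hF4 i, ?_, ?_⟩ <;>
      simp only [Set.mem_insert_iff, Set.mem_ofPred_eq, Finset.mem_insert, Finset.mem_singleton] <;>
      grind
  · refine ⟨_, hF5 i, ?_, ?_⟩ <;>
      simp only [Set.mem_insert_iff, Set.mem_ofPred_eq, Finset.mem_insert, Finset.mem_singleton] <;>
      grind

/-- Extension to a triangle `abc` with outer neighbours `a'`, `b'`, `c'`, of a coloring which
remains valid when `a'` and `b'` are joined. -/
theorem IsForestColoring.extend_triangle [DecidableEq V] {a b c a' b' c' : V}
    (hf : IsForestColoring (G ⊔ SimpleGraph.edge a' b') (U \ {a, b, c}) f)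
    (hab : a ≠ b) (hac : a ≠ c) (hbc : b ≠ c) (hne : a' ≠ b') (hab' : ¬ G.Adj a' b')
    (ha : ∀ w ∈ U, G.Adj a w → w = b ∨ w = c ∨ w = a')
    (hb : ∀ w ∈ U, G.Adj b w → w = a ∨ w = c ∨ w = b')
    (hc : ∀ w ∈ U, G.Adj c w → w = a ∨ w = b ∨ w = c') : ∃ g, IsForestColoring G U g := by
  have hmem : ∀ {w i}, i ∈ f w → w ∈ U ∧ w ≠ a ∧ w ≠ b ∧ w ≠ c := fun h => by
    simpa [not_or] using hf.mem h
  obtain ⟨T, hT, hT3⟩ := Finset.exists_superset_card_eq (hf.card_le c') (by simp)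
  obtain ⟨c₃, c₄, c₅, h34, h35, h45, rfl⟩ := Finset.card_eq_three.1 hT3
  obtain ⟨c₁, c₂, h12, hcompl⟩ := Finset.card_eq_two.1
    (show ({c₃, c₄, c₅} : Finset (Fin 5))ᶜ.card = 2 by rw [Finset.card_compl, hT3]; rfl)
  have hpart : ∀ i, i = c₁ ∨ i = c₂ ∨ i = c₃ ∨ i = c₄ ∨ i = c₅ := by
    intro i
    have := Finset.ext_iff.1 hcompl i
    simp only [Finset.mem_compl, Finset.mem_insert, Finset.mem_singleton] at this
    tauto
  have hc1 : c₁ ∉ ({c₃, c₄, c₅} : Finset (Fin 5)) := by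
    rw [← Finset.mem_compl, hcompl]; simp
  have hc2 : c₂ ∉ ({c₃, c₄, c₅} : Finset (Fin 5)) := by
    rw [← Finset.mem_compl, hcompl]; simp
  have h1c : c₁ ∉ f c' := fun h => hc1 (hT h)
  have h2c : c₂ ∉ f c' := fun h => hc2 (hT h)
  simp only [Finset.mem_insert, Finset.mem_singleton, not_or] at hc1 hc2
  -- The colors `c₁`, `c₂` avoid c', so there c is a leaf on a or on b. In classes `c₄` and `c₅` the
  -- path a' a b b' replaces the added edge a'b'.
  refine hf.extend_sdiff (fun w => if w = a then {c₁, c₄, c₅} else if w = b then {c₂, c₄, c₅} else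
    {c₁, c₂, c₃}) ?_ ?_
  · intro v hv
    simp only [Finset.mem_insert, Finset.mem_singleton] at hv
    rcases hv with rfl | rfl | rfl <;> grind
  intro i
  have hG : ∀ i, IsForestOn G {w | i ∈ f w} := fun i => (hf.forest i).mono_graph le_sup_left
  have hNa : ∀ i, ∀ u ∈ {w | i ∈ f w}, G.Adj a u → u = a' := fun i u hu hau => by
    have := ha u (hmem hu).1 hau
    have := hmem hu
    grind
  have hNb : ∀ i, ∀ u ∈ {w | i ∈ f w}, G.Adj b u → u = b' := fun i u hu hau => by
    have := hb u (hmem hu).1 hau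
    have := hmem hu
    grind
  have hNc : ∀ i, ∀ u ∈ {w | i ∈ f w}, G.Adj c u → u = c' := fun i u hu hau => by
    have := hc u (hmem hu).1 hau
    have := hmem hu
    grind
  have hF1 : ∀ i, i ∉ f c' → IsForestOn G (insert c (insert a {w | i ∈ f w})) := by
    intro i hi
    refine ((hG i).insert_leaf a a' (hNa i)).insert_leaf c a ?_
    rintro u (rfl | hu) hcu
    · rfl
    · exact absurd hu (hNc i u hu hcu ▸ hi)
  have hF2 : ∀ i, i ∉ f c' → IsForestOn G (insert c (insert b {w | i ∈ f w})) := by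
    intro i hi
    refine ((hG i).insert_leaf b b' (hNb i)).insert_leaf c b ?_
    rintro u (rfl | hu) hcu
    · rfl
    · exact absurd hu (hNc i u hu hcu ▸ hi)
  have hF3 : ∀ i, IsForestOn G (insert c {w | i ∈ f w}) := fun i =>
    (hG i).insert_leaf c c' (hNc i)
  have hF4 : ∀ i, IsForestOn G (insert a (insert b {w | i ∈ f w})) := fun i =>
    (hf.forest i).subdivide_two hne hab' hab (fun h => (hmem h).2.1 rfl)
      (fun h => (hmem h).2.2.1 rfl) (hNa i) (hNb i)
  rcases hpart i with rfl | rfl | rfl | rfl | rfl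
  · refine ⟨_, hF1 i h1c, ?_, ?_⟩ <;>
      simp only [Set.mem_insert_iff, Set.mem_ofPred_eq, Finset.mem_insert, Finset.mem_singleton] <;>
      grind
  · refine ⟨_, hF2 i h2c, ?_, ?_⟩ <;>
      simp only [Set.mem_insert_iff, Set.mem_ofPred_eq, Finset.mem_insert, Finset.mem_singleton] <;>
      grind
  · refine ⟨_, hF3 i, ?_, ?_⟩ <;>
      simp only [Set.mem_insert_iff, Set.mem_ofPred_eq, Finset.mem_insert, Finset.mem_singleton] <;>
      grind
  · refine ⟨_, hF4 i, ?_, ?_⟩ <;>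
      simp only [Set.mem_insert_iff, Set.mem_ofPred_eq, Finset.mem_insert, Finset.mem_singleton] <;>
      grind
  · refine ⟨_, hF4 i, ?_, ?_⟩ <;>
      simp only [Set.mem_insert_iff, Set.mem_ofPred_eq, Finset.mem_insert, Finset.mem_singleton] <;>
      grind

theorem IsForestOn.insert_path {F : Set V} (h : IsForestOn G F) {p q r s : V}
    (hp : ∀ u ∈ F, ¬ G.Adj p u) (hq : ∀ u ∈ F, ¬ G.Adj q u) (hr : ∀ u ∈ F, ¬ G.Adj r u)
    (hs : ∀ u ∈ F, ¬ G.Adj s u) (hrp : ¬ G.Adj r p) (hsp : ¬ G.Adj s p) (hsq : ¬ G.Adj s q) :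
    IsForestOn G (insert s (insert r (insert q (insert p F)))) := by
  refine (((h.insert_isolated p hp).insert_leaf q p ?_).insert_leaf r q ?_).insert_leaf s r ?_
  · rintro u (rfl | hu) hqu
    · rfl
    · exact absurd hqu (hq u hu)
  · rintro u (rfl | rfl | hu) hru
    · rfl
    · exact absurd hru hrp
    · exact absurd hru (hr u hu)
  · rintro u (rfl | rfl | rfl | hu) hsu
    · rfl
    · exact absurd hsu hsq
    · exact absurd hsu hsp
    · exact absurd hsu (hs u hu)

theorem IsForestOn.insert_star {F : Set V} (h : IsForestOn G F) {p q r s : V}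
    (hp : ∀ u ∈ F, ¬ G.Adj p u) (hq : ∀ u ∈ F, ¬ G.Adj q u) (hr : ∀ u ∈ F, ¬ G.Adj r u)
    (hs : ∀ u ∈ F, ¬ G.Adj s u) (hrq : ¬ G.Adj r q) (hsq : ¬ G.Adj s q) (hsr : ¬ G.Adj s r) :
    IsForestOn G (insert s (insert r (insert q (insert p F)))) := by
  refine (((h.insert_isolated p hp).insert_leaf q p ?_).insert_leaf r p ?_).insert_leaf s p ?_
  · rintro u (rfl | hu) hqu
    · rfl
    · exact absurd hqu (hq u hu)
  · rintro u (rfl | rfl | hu) hru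
    · exact absurd hru hrq
    · rfl
    · exact absurd hru (hr u hu)
  · rintro u (rfl | rfl | rfl | hu) hsu
    · exact absurd hsu hsr
    · exact absurd hsu hsq
    · rfl
    · exact absurd hsu (hs u hu)

/-- The prism has no edges to the other colored vertices, so an explicit coloring works: colors 0 to
3 each induce a path on four vertices, and color 4 occurs only on the edge cc'. -/
theorem IsForestColoring.extend_prism [DecidableEq V] {a b c a' b' c' : V}
    (hf : IsForestColoring G (U \ {a, b, c, a', b', c'}) f)
    (hnd : [a, b, c, a', b', c'].Nodup) (haU : a ∈ U) (hbU : b ∈ U) (ha'U : a' ∈ U)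
    (hb'U : b' ∈ U) (hc'U : c' ∈ U)
    (ha : ∀ w ∈ U, G.Adj a w → w = b ∨ w = c ∨ w = a')
    (hb : ∀ w ∈ U, G.Adj b w → w = a ∨ w = c ∨ w = b')
    (hc : ∀ w ∈ U, G.Adj c w → w = a ∨ w = b ∨ w = c')
    (ha' : ∀ w ∈ U, G.Adj a' w → w = a ∨ w = b' ∨ w = c')
    (hb' : ∀ w ∈ U, G.Adj b' w → w = b ∨ w = a' ∨ w = c')
    (hc' : ∀ w ∈ U, G.Adj c' w → w = c ∨ w = a' ∨ w = b') : ∃ g, IsForestColoring G U g := by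
  have hmem : ∀ {w i}, i ∈ f w → w ∈ U ∧ w ≠ a ∧ w ≠ b ∧ w ≠ c ∧ w ≠ a' ∧ w ≠ b' ∧ w ≠ c' :=
    fun h => by simpa [not_or] using hf.mem h
  simp only [List.nodup_cons, List.mem_cons, List.not_mem_nil, or_false, not_or] at hnd
  refine hf.extend_sdiff (fun w => if w = a then {0, 2, 3} else if w = b then {1, 2, 3} else
    if w = c then {0, 1, 4} else if w = a' then {0, 1, 2} else if w = b' then {0, 1, 3} else
    {2, 3, 4}) ?_ ?_
  · intro v hv
    simp only [Finset.mem_insert, Finset.mem_singleton] at hv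
    rcases hv with rfl | rfl | rfl | rfl | rfl | rfl <;> grind
  intro i
  have hout : ∀ z, z = a ∨ z = b ∨ z = c ∨ z = a' ∨ z = b' ∨ z = c' →
      ∀ u ∈ {w | i ∈ f w}, ¬ G.Adj z u := by
    intro z hz u hu hzu
    have := hmem hu
    rcases hz with rfl | rfl | rfl | rfl | rfl | rfl
    · have := ha u this.1 hzu
      grind
    · have := hb u this.1 hzu
      grind
    · have := hc u this.1 hzu
      grind
    · have := ha' u this.1 hzu
      grind
    · have := hb' u this.1 hzu
      grind
    · have := hc' u this.1 hzu
      grind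
  have oa := hout a (by simp)
  have ob := hout b (by simp)
  have oc := hout c (by simp)
  have oa' := hout a' (by simp)
  have ob' := hout b' (by simp)
  have oc' := hout c' (by simp)
  have hab' : ¬ G.Adj a b' := fun h => by have := ha b' hb'U h; grind
  have hac' : ¬ G.Adj a c' := fun h => by have := ha c' hc'U h; grind
  have hba' : ¬ G.Adj b a' := fun h => by have := hb a' ha'U h; grind
  have hbc' : ¬ G.Adj b c' := fun h => by have := hb c' hc'U h; grind
  have hca' : ¬ G.Adj c a' := fun h => by have := hc a' ha'U h; grind
  have hcb' : ¬ G.Adj c b' := fun h => by have := hc b' hb'U h; grind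
  have hi : i = 0 ∨ i = 1 ∨ i = 2 ∨ i = 3 ∨ i = 4 := by fin_cases i <;> simp
  have hF := hf.forest i
  rcases hi with rfl | rfl | rfl | rfl | rfl
  · refine ⟨_, hF.insert_path ob' oa' oa oc hab' hcb' hca', ?_, ?_⟩ <;>
      simp only [Set.mem_insert_iff, Set.mem_ofPred_eq, Finset.mem_insert, Finset.mem_singleton] <;>
      grind
  · refine ⟨_, hF.insert_path oa' ob' ob oc hba' hca' hcb', ?_, ?_⟩ <;>
      simp only [Set.mem_insert_iff, Set.mem_ofPred_eq, Finset.mem_insert, Finset.mem_singleton] <;>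
      grind
  · refine ⟨_, hF.insert_path oc' oa' oa ob hac' hbc' hba', ?_, ?_⟩ <;>
      simp only [Set.mem_insert_iff, Set.mem_ofPred_eq, Finset.mem_insert, Finset.mem_singleton] <;>
      grind
  · refine ⟨_, hF.insert_path oc' ob' ob oa hbc' hac' hab', ?_, ?_⟩ <;>
      simp only [Set.mem_insert_iff, Set.mem_ofPred_eq, Finset.mem_insert, Finset.mem_singleton] <;>
      grind
  -- Only c and c' have color 4; the path b' c' c a is a convenient larger forest.
  · refine ⟨_, hF.insert_path ob' oc' oc oa hcb' hab' hac', ?_, ?_⟩ <;>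
      simp only [Set.mem_insert_iff, Set.mem_ofPred_eq, Finset.mem_insert, Finset.mem_singleton] <;>
      grind

/-- Colors 0 to 3 induce stars centered at a', b', a, b, and color 4 occurs only at c and c'. -/
theorem IsForestColoring.extend_completeBipartite [DecidableEq V] {a b c a' b' c' : V}
    (hf : IsForestColoring G (U \ {a, b, c, a', b', c'}) f)
    (hnd : [a, b, c, a', b', c'].Nodup) (haU : a ∈ U) (hbU : b ∈ U) (ha'U : a' ∈ U)
    (hb'U : b' ∈ U)
    (ha : ∀ w ∈ U, G.Adj a w → w = a' ∨ w = b' ∨ w = c')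
    (hb : ∀ w ∈ U, G.Adj b w → w = a' ∨ w = b' ∨ w = c')
    (hc : ∀ w ∈ U, G.Adj c w → w = a' ∨ w = b' ∨ w = c')
    (ha' : ∀ w ∈ U, G.Adj a' w → w = a ∨ w = b ∨ w = c)
    (hb' : ∀ w ∈ U, G.Adj b' w → w = a ∨ w = b ∨ w = c)
    (hc' : ∀ w ∈ U, G.Adj c' w → w = a ∨ w = b ∨ w = c) : ∃ g, IsForestColoring G U g := by
  have hmem : ∀ {w i}, i ∈ f w → w ∈ U ∧ w ≠ a ∧ w ≠ b ∧ w ≠ c ∧ w ≠ a' ∧ w ≠ b' ∧ w ≠ c' :=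
    fun h => by simpa [not_or] using hf.mem h
  simp only [List.nodup_cons, List.mem_cons, List.not_mem_nil, or_false, not_or] at hnd
  refine hf.extend_sdiff (fun w => if w = a then {0, 1, 2} else if w = b then {0, 1, 3} else
    if w = c then {0, 1, 4} else if w = a' then {0, 2, 3} else if w = b' then {1, 2, 3} else
    {2, 3, 4}) ?_ ?_
  · intro v hv
    simp only [Finset.mem_insert, Finset.mem_singleton] at hv
    rcases hv with rfl | rfl | rfl | rfl | rfl | rfl <;> grind
  intro i
  have hout : ∀ z, z = a ∨ z = b ∨ z = c ∨ z = a' ∨ z = b' ∨ z = c' →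
      ∀ u ∈ {w | i ∈ f w}, ¬ G.Adj z u := by
    intro z hz u hu hzu
    have := hmem hu
    rcases hz with rfl | rfl | rfl | rfl | rfl | rfl
    · have := ha u this.1 hzu
      grind
    · have := hb u this.1 hzu
      grind
    · have := hc u this.1 hzu
      grind
    · have := ha' u this.1 hzu
      grind
    · have := hb' u this.1 hzu
      grind
    · have := hc' u this.1 hzu
      grind
  have oa := hout a (by simp)
  have ob := hout b (by simp)
  have oc := hout c (by simp)
  have oa' := hout a' (by simp)
  have ob' := hout b' (by simp)
  have oc' := hout c' (by simp)
  have hba : ¬ G.Adj b a := fun h => by have := hb a haU h; grind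
  have hca : ¬ G.Adj c a := fun h => by have := hc a haU h; grind
  have hcb : ¬ G.Adj c b := fun h => by have := hc b hbU h; grind
  have hba' : ¬ G.Adj b' a' := fun h => by have := hb' a' ha'U h; grind
  have hca' : ¬ G.Adj c' a' := fun h => by have := hc' a' ha'U h; grind
  have hcb' : ¬ G.Adj c' b' := fun h => by have := hc' b' hb'U h; grind
  have hi : i = 0 ∨ i = 1 ∨ i = 2 ∨ i = 3 ∨ i = 4 := by fin_cases i <;> simp
  have hF := hf.forest i
  rcases hi with rfl | rfl | rfl | rfl | rfl
  · refine ⟨_, hF.insert_star oa' oa ob oc hba hca hcb, ?_, ?_⟩ <;>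
      simp only [Set.mem_insert_iff, Set.mem_ofPred_eq, Finset.mem_insert, Finset.mem_singleton] <;>
      grind
  · refine ⟨_, hF.insert_star ob' oa ob oc hba hca hcb, ?_, ?_⟩ <;>
      simp only [Set.mem_insert_iff, Set.mem_ofPred_eq, Finset.mem_insert, Finset.mem_singleton] <;>
      grind
  · refine ⟨_, hF.insert_star oa oa' ob' oc' hba' hca' hcb', ?_, ?_⟩ <;>
      simp only [Set.mem_insert_iff, Set.mem_ofPred_eq, Finset.mem_insert, Finset.mem_singleton] <;>
      grind
  · refine ⟨_, hF.insert_star ob oa' ob' oc' hba' hca' hcb', ?_, ?_⟩ <;>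
      simp only [Set.mem_insert_iff, Set.mem_ofPred_eq, Finset.mem_insert, Finset.mem_singleton] <;>
      grind
  · refine ⟨_, hF.insert_star oc' oa ob oc hba hca hcb, ?_, ?_⟩ <;>
      simp only [Set.mem_insert_iff, Set.mem_ofPred_eq, Finset.mem_insert, Finset.mem_singleton] <;>
      grind

end SignedGraph

/-! ### Reinserting two adjacent vertices. -/

namespace SignedGraph

variable {V : Type*} {G : SimpleGraph V} {U : Finset V} {f : V → Finset (Fin 5)}

/-- Extension to two vertices `v`, `z` which share the color `k` only. -/
theorem IsForestColoring.extend_pair [DecidableEq V] {v z : V} (hvz : v ≠ z)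
    (hf : IsForestColoring G (U \ {v, z}) f) (k : Fin 5) (Z : Finset (Fin 5)) (hZ : Z.card = 3)
    (hk : k ∈ Z) (hFk : IsForestOn G (insert v (insert z {w | k ∈ f w})))
    (hFz : ∀ i ∈ Z, i ≠ k → IsForestOn G (insert z {w | i ∈ f w}))
    (hFv : ∀ i ∉ Z, IsForestOn G (insert v {w | i ∈ f w})) : ∃ g, IsForestColoring G U g := by
  -- Three colors at z leave two for v, so v needs just one color of z, namely k.
  refine hf.extend_sdiff (fun w => if w = v then insert k Zᶜ else Z) ?_ ?_
  · intro w hw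
    simp only [Finset.mem_insert, Finset.mem_singleton] at hw
    rcases hw with rfl | rfl
    · rw [if_pos rfl, Finset.card_insert_of_notMem (by simpa using hk), Finset.card_compl, hZ]
      simp
    · rw [if_neg hvz.symm, hZ]
  · intro i
    by_cases hik : i = k
    · subst hik
      refine ⟨_, hFk, ?_, ?_⟩ <;>
        simp only [Set.mem_insert_iff, Set.mem_ofPred_eq, Finset.mem_insert,
          Finset.mem_singleton] <;> grind [Finset.mem_compl]
    by_cases hiZ : i ∈ Z
    · refine ⟨_, hFz i hiZ hik, ?_, ?_⟩ <;>
        simp only [Set.mem_insert_iff, Set.mem_ofPred_eq, Finset.mem_insert,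
          Finset.mem_singleton] <;> grind [Finset.mem_compl]
    · refine ⟨_, hFv i hiZ, ?_, ?_⟩ <;>
        simp only [Set.mem_insert_iff, Set.mem_ofPred_eq, Finset.mem_insert,
          Finset.mem_singleton] <;> grind [Finset.mem_compl]

theorem IsForestColoring.extend_pair_of_shared [DecidableEq V] {v z : V} (hvz : v ≠ z)
    (hf : IsForestColoring G (U \ {v, z}) f)
    (hFv : ∀ i, IsForestOn G (insert v {w | i ∈ f w}))
    (hFz : ∀ i, IsForestOn G (insert z {w | i ∈ f w}))
    (k : Fin 5) (hFk : IsForestOn G (insert v (insert z {w | k ∈ f w}))) :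
    ∃ g, IsForestColoring G U g := by
  obtain ⟨Z, hkZ, hZ⟩ := Finset.exists_superset_card_eq (s := {k}) (n := 3) (by simp) (by simp)
  exact hf.extend_pair hvz k Z hZ (by simpa using hkZ) hFk (fun i _ _ => hFz i) fun i _ => hFv i

/-- Extension to `v` and `z` by moving a color of the neighbour `x` of `v`. -/
theorem IsForestColoring.extend_pair_of_swap [DecidableEq V] {v z x y p q : V} (hvz : v ≠ z)
    (hf : IsForestColoring G (U \ {v, z}) f)
    (hFv : ∀ i, IsForestOn G (insert v {w | i ∈ f w}))
    (hFz : ∀ i, IsForestOn G (insert z {w | i ∈ f w}))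
    (hv : ∀ w ∈ U, G.Adj v w → w = z ∨ w = x ∨ w = y)
    (hx : ∀ w ∈ U, G.Adj x w → w = v ∨ w = p ∨ w = q) (hxz : ¬ G.Adj x z)
    {k j : Fin 5} (hkx : k ∈ f x) (hky : k ∉ f y) (hjx : j ∉ f x) (hj : j ∉ f p ∩ f q) :
    ∃ g, IsForestColoring G U g := by
  have hmem : ∀ {w i}, i ∈ f w → w ∈ U ∧ w ≠ v ∧ w ≠ z := fun h => by
    simpa [not_or] using hf.mem h
  have hkj : k ≠ j := fun h => hjx (h ▸ hkx)
  have hxU := hmem hkx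
  have hFj : IsForestOn G (insert x (insert z {w | j ∈ f w})) := by
    by_cases hjp : j ∈ f p
    · refine (hFz j).insert_leaf x p ?_
      rintro u (rfl | hu) hxu
      · exact absurd hxu hxz
      · have := hx u (hmem hu).1 hxu
        have := hmem hu
        simp only [Set.mem_ofPred_eq] at hu
        grind
    · refine (hFz j).insert_leaf x q ?_
      rintro u (rfl | hu) hxu
      · exact absurd hxu hxz
      · have := hx u (hmem hu).1 hxu
        have := hmem hu
        simp only [Set.mem_ofPred_eq] at hu
        grind
  set f' := Function.update f x (insert j ((f x).erase k)) with hf'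
  have hclass : ∀ i w, i ∈ f' w →
      (w = x ∧ (i = j ∨ i ≠ k ∧ i ∈ f x)) ∨ (w ≠ x ∧ i ∈ f w) := by
    intro i w hw
    by_cases hwx : w = x
    · subst hwx
      exact .inl ⟨rfl, by simpa [hf'] using hw⟩
    · rw [hf', Function.update_of_ne hwx] at hw
      exact .inr ⟨hwx, hw⟩
  have hsub : ∀ i, i ≠ j → {w | i ∈ f' w} ⊆ {w | i ∈ f w} := by
    intro i hi w hw
    have := hclass i w hw
    simp only [Set.mem_ofPred_eq]
    grind
  have hsubj : {w | j ∈ f' w} ⊆ insert x {w | j ∈ f w} := by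
    intro w hw
    have := hclass j w hw
    simp only [Set.mem_insert_iff, Set.mem_ofPred_eq]
    grind
  have hcol : IsForestColoring G (U \ {v, z}) f' := by
    refine ⟨fun w hw => ?_, fun w hw => ?_, fun i => ?_⟩
    · by_cases hwx : w = x
      · subst hwx
        rw [hf', Function.update_self, Finset.card_insert_of_notMem (by simp [hjx]),
          Finset.card_erase_of_mem hkx, hf.card w hw]
      · rw [hf', Function.update_of_ne hwx, hf.card w hw]
    · have hwx : w ≠ x := fun h => hw (h ▸ hf.mem hkx)
      rw [hf', Function.update_of_ne hwx, hf.empty w hw]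
    · by_cases hi : i = j
      · subst hi
        exact (hFj.mono (Set.insert_subset_insert (Set.subset_insert _ _))).mono hsubj
      · exact (hf.forest i).mono (hsub i hi)
  -- Putting j into Z keeps it away from v, where the new color j of x might close a cycle. The
  -- shared color is k: x has given it up and y lacks it, so v is a leaf on z.
  obtain ⟨Z, hkZ, hZ⟩ := Finset.exists_superset_card_eq (s := {k, j}) (n := 3)
    (by rw [Finset.card_pair hkj]; norm_num) (by simp)
  have hk : k ∈ Z := hkZ (by simp)
  have hjZ : j ∈ Z := hkZ (by simp)
  refine hcol.extend_pair hvz k Z hZ hk ?_ ?_ ?_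
  · refine ((hFz k).mono (Set.insert_subset_insert (hsub k hkj))).insert_leaf v z ?_
    rintro u (rfl | hu) hvu
    · rfl
    · have h1 := hclass k u hu
      have h2 := hmem (hsub k hkj hu)
      have h3 := hv u h2.1 hvu
      grind
  · intro i hi hik
    by_cases hij : i = j
    · subst hij
      rw [Set.insert_comm] at hFj
      exact hFj.mono (Set.insert_subset_insert hsubj)
    · exact (hFz i).mono (Set.insert_subset_insert (hsub i hij))
  · intro i hi
    have hij : i ≠ j := fun h => hi (h ▸ hjZ)
    exact (hFv i).mono (Set.insert_subset_insert (hsub i hij))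

/-- If no extension exists, the two colors missing at x lie at both p and q, since otherwise an
exchange at x would help. The two colors in `f x \ f y` lie at p or q, since otherwise x could be
rehung on v. So p and q share at least two colors and together have at most 6 - 2 = 4, all now
accounted for. None is left for the common color a of x and y. -/
theorem IsForestColoring.notMem_of_not_extend_pair [DecidableEq V] {v z x y p q : V} (hvz : v ≠ z)
    (hf : IsForestColoring G (U \ {v, z}) f)
    (hFv : ∀ i, IsForestOn G (insert v {w | i ∈ f w}))
    (hFz : ∀ i, IsForestOn G (insert z {w | i ∈ f w}))
    (hv : ∀ w ∈ U, G.Adj v w → w = z ∨ w = x ∨ w = y)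
    (hx : ∀ w ∈ U, G.Adj x w → w = v ∨ w = p ∨ w = q) (hxz : ¬ G.Adj x z)
    (hbad : ¬ ∃ g, IsForestColoring G U g) (hxy : f x ∪ f y = Finset.univ)
    {a : Fin 5} (hax : a ∈ f x) (hay : a ∈ f y) : a ∉ f p ∧ a ∉ f q := by
  have hmem : ∀ {w i}, i ∈ f w → w ∈ U ∧ w ≠ v ∧ w ≠ z := fun h => by
    simpa [not_or] using hf.mem h
  have hcx : (f x).card = 3 := hf.card x (hf.mem hax)
  have hcy : (f y).card = 3 := hf.card y (hf.mem hay)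
  have hint : (f x ∩ f y).card = 1 := by
    have := Finset.card_union_add_card_inter (f x) (f y)
    rw [hxy, Finset.card_univ, Fintype.card_fin] at this
    omega
  have hdiff : (f x \ f y).card = 2 := by
    have := Finset.card_sdiff_add_card_inter (f x) (f y)
    omega
  have hswap : ∀ k ∈ f x \ f y, ∀ j ∉ f x, j ∈ f p ∩ f q := by
    intro k hk j hj
    by_contra hjpq
    rw [Finset.mem_sdiff] at hk
    exact hbad (hf.extend_pair_of_swap hvz hFv hFz hv hx hxz hk.1 hk.2 hj hjpq)
  have hcov : ∀ k ∈ f x \ f y, k ∈ f p ∪ f q := by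
    intro k hk
    by_contra hpq
    rw [Finset.mem_sdiff] at hk
    simp only [Finset.mem_union, not_or] at hpq
    refine hbad (hf.extend_pair_of_shared hvz hFv hFz k ?_)
    have h1 : IsForestOn G (insert v (insert z ({w | k ∈ f w} \ {x}))) := by
      refine ((hFz k).mono (Set.insert_subset_insert Set.sdiff_subset)).insert_leaf v z ?_
      rintro u (rfl | ⟨hu, hux⟩) hvu
      · rfl
      · have h3 := hv u (hmem hu).1 hvu
        simp only [Set.mem_ofPred_eq, Set.mem_singleton_iff] at hu hux
        grind
    have h2 : IsForestOn G (insert x (insert v (insert z ({w | k ∈ f w} \ {x})))) := by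
      refine h1.insert_leaf x v ?_
      rintro u (rfl | rfl | ⟨hu, hux⟩) hxu
      · rfl
      · exact absurd hxu hxz
      · have h3 := hx u (hmem hu).1 hxu
        simp only [Set.mem_ofPred_eq] at hu
        grind
    refine h2.mono fun w hw => ?_
    simp only [Set.mem_insert_iff, Set.mem_sdiff, Set.mem_singleton_iff] at hw ⊢
    tauto
  obtain ⟨k, hk⟩ : (f x \ f y).Nonempty := Finset.card_pos.1 (by omega)
  have hcompl : (f x)ᶜ ⊆ f p ∩ f q := fun j hj => hswap k hk j (by simpa using hj)
  have h1 := Finset.card_le_card hcompl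
  have h2 := Finset.card_union_add_card_inter (f p) (f q)
  have h3 := hf.card_le p
  have h4 := hf.card_le q
  rw [Finset.card_compl, hcx, Fintype.card_fin] at h1
  have hsub : (f x)ᶜ ∪ (f x \ f y) ⊆ f p ∪ f q := by
    intro j hj
    rcases Finset.mem_union.1 hj with hj | hj
    · exact Finset.mem_union_left _ (Finset.mem_inter.1 (hcompl hj)).1
    · exact hcov j hj
  have h5 : ((f x)ᶜ ∪ (f x \ f y)).card = 4 := by
    rw [Finset.card_union_of_disjoint, Finset.card_compl, hcx, hdiff, Fintype.card_fin]
    rw [Finset.disjoint_left]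
    intro j hj hj'
    simp only [Finset.mem_compl, Finset.mem_sdiff] at hj hj'
    exact hj hj'.1
  have heq := Finset.eq_of_subset_of_card_le hsub (by omega)
  have : a ∉ f p ∪ f q := by
    rw [← heq]
    simp [hax, hay]
  simpa using this

/-- If no color can be shared by v and z, then x and y together carry all five colors, hence have a
common color a. By the previous count, applied at x and at y, a is absent from the further neighbors
of both. In class a one can then hang v on z, and x and y on v, so a can be shared after all. -/
theorem IsForestColoring.extend_adjacent_pair [DecidableEq V] {v z x y x₁ x₂ y₁ y₂ : V}
    (hvz : v ≠ z) (hf : IsForestColoring G (U \ {v, z}) f)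
    (hFv : ∀ i, IsForestOn G (insert v {w | i ∈ f w}))
    (hFz : ∀ i, IsForestOn G (insert z {w | i ∈ f w}))
    (hv : ∀ w ∈ U, G.Adj v w → w = z ∨ w = x ∨ w = y)
    (hx : ∀ w ∈ U, G.Adj x w → w = v ∨ w = x₁ ∨ w = x₂) (hxz : ¬ G.Adj x z)
    (hy : ∀ w ∈ U, G.Adj y w → w = v ∨ w = y₁ ∨ w = y₂) (hyz : ¬ G.Adj y z) :
    ∃ g, IsForestColoring G U g := by
  have hmem : ∀ {w i}, i ∈ f w → w ∈ U ∧ w ≠ v ∧ w ≠ z := fun h => by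
    simpa [not_or] using hf.mem h
  by_contra hbad
  have hblock : ∀ k, ¬ IsForestOn G (insert v (insert z {w | k ∈ f w})) := fun k hk =>
    hbad (hf.extend_pair_of_shared hvz hFv hFz k hk)
  have hxy : f x ∪ f y = Finset.univ := by
    refine Finset.eq_univ_iff_forall.2 fun k => ?_
    by_contra hk
    simp only [Finset.mem_union, not_or] at hk
    refine hblock k ((hFz k).insert_leaf v z ?_)
    rintro u (rfl | hu) hvu
    · rfl
    · have h3 := hv u (hmem hu).1 hvu
      simp only [Set.mem_ofPred_eq] at hu
      grind
  obtain ⟨a, ha⟩ : (f x ∩ f y).Nonempty := by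
    rw [← Finset.card_pos]
    have h1 := Finset.card_union_add_card_inter (f x) (f y)
    rw [hxy, Finset.card_univ, Fintype.card_fin] at h1
    by_contra h0
    by_cases hxU : x ∈ U \ {v, z}
    · by_cases hyU : y ∈ U \ {v, z}
      · rw [hf.card x hxU, hf.card y hyU] at h1
        omega
      · rw [hf.empty y hyU] at h1
        have := hf.card_le x
        simp at h1
        omega
    · rw [hf.empty x hxU] at h1
      have := hf.card_le y
      simp at h1
      omega
  obtain ⟨hax, hay⟩ := Finset.mem_inter.1 ha
  obtain ⟨hx1, hx2⟩ := hf.notMem_of_not_extend_pair hvz hFv hFz hv hx hxz hbad hxy hax hay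
  obtain ⟨hy1, hy2⟩ := hf.notMem_of_not_extend_pair (x := y) (y := x) hvz hFv hFz
    (fun w hw hvw => (hv w hw hvw).imp_right Or.symm) hy hyz hbad (by rwa [Finset.union_comm])
    hay hax
  refine hblock a ?_
  have h1 : IsForestOn G (insert v (insert z ({w | a ∈ f w} \ {x, y}))) := by
    refine ((hFz a).mono (Set.insert_subset_insert Set.sdiff_subset)).insert_leaf v z ?_
    rintro u (rfl | ⟨hu, hux⟩) hvu
    · rfl
    · have h3 := hv u (hmem hu).1 hvu
      simp only [Set.mem_insert_iff, Set.mem_singleton_iff] at hux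
      grind
  have h2 : IsForestOn G (insert x (insert v (insert z ({w | a ∈ f w} \ {x, y})))) := by
    refine h1.insert_leaf x v ?_
    rintro u (rfl | rfl | ⟨hu, hux⟩) hxu
    · rfl
    · exact absurd hxu hxz
    · have h3 := hx u (hmem hu).1 hxu
      simp only [Set.mem_ofPred_eq] at hu
      grind
  have h3 : IsForestOn G
      (insert y (insert x (insert v (insert z ({w | a ∈ f w} \ {x, y}))))) := by
    refine h2.insert_leaf y v ?_
    rintro u (rfl | rfl | rfl | ⟨hu, hux⟩) hyu
    · have h3 := hy u (hmem hax).1 hyu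
      grind
    · rfl
    · exact absurd hyu hyz
    · have h3 := hy u (hmem hu).1 hyu
      simp only [Set.mem_ofPred_eq] at hu
      grind
  refine h3.mono fun w hw => ?_
  simp only [Set.mem_insert_iff, Set.mem_sdiff, Set.mem_singleton_iff] at hw ⊢
  tauto

end SignedGraph

/-! ### Local structure of subcubic graphs and the effect of adding an edge. -/

namespace SignedGraph

variable {V : Type*}

/-- Every vertex of `U` has at most three neighbours in `U`. -/
def IsSubcubicOn (G : SimpleGraph V) (U : Finset V) : Prop :=
  ∀ v ∈ U, ∃ a b c, ∀ w ∈ U, G.Adj v w → w = a ∨ w = b ∨ w = c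

/-- No four vertices of `U` are pairwise adjacent. -/
def IsK4FreeOn (G : SimpleGraph V) (U : Finset V) : Prop :=
  ∀ a ∈ U, ∀ b ∈ U, ∀ c ∈ U, ∀ d ∈ U, G.Adj a b → G.Adj a c → G.Adj a d → G.Adj b c →
    G.Adj b d → ¬ G.Adj c d

/-- Every vertex of `U` has at least three neighbours in `U`. -/
def HasThreeNeighborsOn (G : SimpleGraph V) (U : Finset V) : Prop :=
  ∀ v ∈ U, ∀ x y, ∃ w ∈ U, G.Adj v w ∧ w ≠ x ∧ w ≠ y

/-- `U` contains no two triangles with a common edge. -/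
def IsDiamondFreeOn (G : SimpleGraph V) (U : Finset V) : Prop :=
  ∀ a ∈ U, ∀ b ∈ U, ∀ c ∈ U, ∀ d ∈ U, G.Adj a b → G.Adj a c → G.Adj b c → G.Adj d b →
    G.Adj d c → a = d

def IsTriangleFreeOn (G : SimpleGraph V) (U : Finset V) : Prop :=
  ∀ a ∈ U, ∀ b ∈ U, ∀ c ∈ U, G.Adj a b → G.Adj a c → ¬ G.Adj b c

variable {G : SimpleGraph V} {U W : Finset V}

theorem IsSubcubicOn.mono (h : IsSubcubicOn G U) (hW : W ⊆ U) : IsSubcubicOn G W := by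
  intro v hv
  obtain ⟨a, b, c, habc⟩ := h v (hW hv)
  exact ⟨a, b, c, fun w hw => habc w (hW hw)⟩

theorem IsK4FreeOn.mono (h : IsK4FreeOn G U) (hW : W ⊆ U) : IsK4FreeOn G W :=
  fun a ha b hb c hc d hd => h a (hW ha) b (hW hb) c (hW hc) d (hW hd)

theorem IsSubcubicOn.others (h : IsSubcubicOn G U) {v p : V} (hv : v ∈ U) (hp : p ∈ U)
    (hvp : G.Adj v p) : ∃ q r, ∀ w ∈ U, G.Adj v w → w = p ∨ w = q ∨ w = r := by
  obtain ⟨a, b, c, habc⟩ := h v hv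
  rcases habc p hp hvp with rfl | rfl | rfl
  · exact ⟨b, c, habc⟩
  · exact ⟨a, c, fun w hw hvw => by have := habc w hw hvw; tauto⟩
  · exact ⟨a, b, fun w hw hvw => by have := habc w hw hvw; tauto⟩

theorem IsSubcubicOn.other (h : IsSubcubicOn G U) {v p q : V} (hv : v ∈ U) (hp : p ∈ U)
    (hq : q ∈ U) (hpq : p ≠ q) (hvp : G.Adj v p) (hvq : G.Adj v q) :
    ∃ r, ∀ w ∈ U, G.Adj v w → w = p ∨ w = q ∨ w = r := by
  obtain ⟨a, b, hab⟩ := h.others hv hp hvp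
  rcases hab q hq hvq with rfl | rfl | rfl
  · exact absurd rfl hpq
  · exact ⟨b, hab⟩
  · exact ⟨a, fun w hw hvw => by have := hab w hw hvw; tauto⟩

theorem IsSubcubicOn.eq_of_adj (h : IsSubcubicOn G U) {v p q r : V} (hv : v ∈ U) (hp : p ∈ U)
    (hq : q ∈ U) (hr : r ∈ U) (hpq : p ≠ q) (hpr : p ≠ r) (hqr : q ≠ r) (hvp : G.Adj v p)
    (hvq : G.Adj v q) (hvr : G.Adj v r) : ∀ w ∈ U, G.Adj v w → w = p ∨ w = q ∨ w = r := by
  obtain ⟨s, hs⟩ := h.other hv hp hq hpq hvp hvq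
  rcases hs r hr hvr with h | h | rfl
  · exact absurd h.symm hpr
  · exact absurd h.symm hqr
  · exact hs

/-- Three neighbors must exist, so three names covering all of them are genuine and distinct
neighbors. -/
theorem HasThreeNeighborsOn.adj (h : HasThreeNeighborsOn G U) {v a b c : V} (hv : v ∈ U)
    (habc : ∀ w ∈ U, G.Adj v w → w = a ∨ w = b ∨ w = c) :
    (a ∈ U ∧ b ∈ U ∧ c ∈ U) ∧ (G.Adj v a ∧ G.Adj v b ∧ G.Adj v c) ∧
      (a ≠ b ∧ a ≠ c ∧ b ≠ c) := by
  obtain ⟨u, hu, hvu, hub, huc⟩ := h v hv b c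
  obtain ⟨u', hu', hvu', hua', huc'⟩ := h v hv a c
  obtain ⟨u'', hu'', hvu'', hua'', hub''⟩ := h v hv a b
  have h1 : u = a := (habc u hu hvu).resolve_right (by tauto)
  have h2 : u' = b := ((habc u' hu' hvu').resolve_left hua').resolve_right huc'
  have h3 : u'' = c := ((habc u'' hu'' hvu'').resolve_left hua'').resolve_left hub''
  subst h1 h2 h3
  exact ⟨⟨hu, hu', hu''⟩, ⟨hvu, hvu', hvu''⟩, hub, huc, huc'⟩

theorem sup_edge_adj_iff {x y p q : V} (hne : x ≠ y) : (G ⊔ SimpleGraph.edge x y).Adj p q ↔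
    G.Adj p q ∨ (p = x ∧ q = y ∨ p = y ∧ q = x) := by
  rw [SimpleGraph.sup_adj, SimpleGraph.edge_adj]
  constructor
  · tauto
  · rintro (h | ⟨rfl, rfl⟩ | ⟨rfl, rfl⟩) <;> simp [*, hne.symm]

/-- Joining two vertices after deleting a neighbour of each keeps the graph subcubic. -/
theorem IsSubcubicOn.sup_edge (hd : IsSubcubicOn G U) (hW : W ⊆ U) {x y p q : V} (hne : x ≠ y)
    (hpU : p ∈ U) (hqU : q ∈ U) (hp : p ∉ W) (hq : q ∉ W) (hxp : G.Adj x p) (hyq : G.Adj y q) :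
    IsSubcubicOn (G ⊔ SimpleGraph.edge x y) W := by
  intro v hv
  by_cases hvx : v = x
  · subst hvx
    obtain ⟨b, c, hbc⟩ := hd.others (hW hv) hpU hxp
    refine ⟨y, b, c, fun w hw hvw => ?_⟩
    rcases (sup_edge_adj_iff hne).1 hvw with h | h
    · rcases hbc w (hW hw) h with rfl | h
      · exact absurd hw hp
      · exact .inr h
    · tauto
  by_cases hvy : v = y
  · subst hvy
    obtain ⟨b, c, hbc⟩ := hd.others (hW hv) hqU hyq
    refine ⟨x, b, c, fun w hw hvw => ?_⟩
    rcases (sup_edge_adj_iff hne).1 hvw with h | h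
    · rcases hbc w (hW hw) h with rfl | h
      · exact absurd hw hq
      · exact .inr h
    · tauto
  obtain ⟨a, b, c, habc⟩ := hd v (hW hv)
  refine ⟨a, b, c, fun w hw hvw => ?_⟩
  rcases (sup_edge_adj_iff hne).1 hvw with h | h
  · exact habc w (hW hw) h
  · tauto

/-- A new K₄ must use the edge xy, and its other two vertices are adjacent common neighbors of x and
y in the old graph. -/
theorem IsK4FreeOn.sup_edge (hK : IsK4FreeOn G U) {x y : V} (hne : x ≠ y)
    (key : ∀ u ∈ U, ∀ w ∈ U, G.Adj x u → G.Adj x w → G.Adj y u → G.Adj y w → ¬ G.Adj u w) :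
    IsK4FreeOn (G ⊔ SimpleGraph.edge x y) U := by
  intro p hp q hq r hr s hs hpq hpr hps hqr hqs hrs
  have n1 := hpq.ne
  have n2 := hpr.ne
  have n3 := hps.ne
  have n4 := hqr.ne
  have n5 := hqs.ne
  have n6 := hrs.ne
  have hK' := hK p hp q hq r hr s hs
  simp only [sup_edge_adj_iff hne] at hpq hpr hps hqr hqs hrs
  have hsym : ∀ {u w}, G.Adj u w → G.Adj w u := fun h => h.symm
  by_cases h1 : G.Adj p q
  · by_cases h2 : G.Adj p r
    · by_cases h3 : G.Adj p s
      · by_cases h4 : G.Adj q r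
        · by_cases h5 : G.Adj q s
          · have h6 := hrs.resolve_left (hK' h1 h2 h3 h4 h5)
            have := key p hp q hq
            grind
          · have h6 := hqs.resolve_left h5
            have := key p hp r hr
            grind
        · have h6 := hqr.resolve_left h4
          have := key p hp s hs
          grind
      · have h6 := hps.resolve_left h3
        have := key q hq r hr
        grind
    · have h6 := hpr.resolve_left h2
      have := key q hq s hs
      grind
  · have h6 := hpq.resolve_left h1
    have := key r hr s hs
    grind

/-! ### The reductions and the induction. -/

/-- Every graph has a coloring on every set smaller than `U` on which it is subcubic and
`K₄`-free. -/
def ColoringHypothesis (U : Finset V) : Prop :=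
  ∀ (H : SimpleGraph V) (W : Finset V), W.card < U.card → IsSubcubicOn H W → IsK4FreeOn H W →
    ∃ f, IsForestColoring H W f

theorem exists_coloring_of_two_neighbors (ih : ColoringHypothesis U) (hd : IsSubcubicOn G U)
    (hK : IsK4FreeOn G U) (h : ¬ HasThreeNeighborsOn G U) : ∃ g, IsForestColoring G U g := by
  classical
  simp only [HasThreeNeighborsOn, not_forall, not_exists, not_and, ne_eq, not_not] at h
  obtain ⟨v, hv, x, y, hxy⟩ := h
  have hxy' : ∀ w ∈ U, G.Adj v w → w = x ∨ w = y := fun w hw hvw => by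
    have := hxy w hw hvw
    tauto
  have hsub := Finset.erase_subset v U
  obtain ⟨f, hf⟩ := ih G (U.erase v) (Finset.card_erase_lt_of_mem hv) (hd.mono hsub)
    (hK.mono hsub)
  by_cases hx : x ∈ U ∧ G.Adj v x
  · obtain ⟨p, q, hpq⟩ := hd.others hx.1 hv hx.2.symm
    exact hf.extend_of_two_neighbors hxy' hpq
  have hy' : ∀ w ∈ U, G.Adj v w → w = y := fun w hw hvw =>
    (hxy' w hw hvw).resolve_left fun h => hx (h ▸ ⟨hw, hvw⟩)
  by_cases hy : y ∈ U ∧ G.Adj v y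
  · obtain ⟨p, q, hpq⟩ := hd.others hy.1 hv hy.2.symm
    exact hf.extend_of_two_neighbors (fun w hw hvw => .inl (hy' w hw hvw)) (y := y) hpq
  have hno : ∀ w ∈ U, ¬ G.Adj v w := fun w hw hvw => hy (hy' w hw hvw ▸ ⟨hw, hvw⟩)
  exact hf.extend_of_two_neighbors (x := v) (y := v) (p := v) (q := v)
    (fun w hw hvw => absurd hvw (hno w hw)) (fun w hw hvw => absurd hvw (hno w hw))

theorem exists_coloring_of_diamond (ih : ColoringHypothesis U) (hd : IsSubcubicOn G U)
    (hK : IsK4FreeOn G U) (h : ¬ IsDiamondFreeOn G U) : ∃ g, IsForestColoring G U g := by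
  classical
  simp only [IsDiamondFreeOn, not_forall] at h
  obtain ⟨a, ha, b, hb, c, hc, d, hdU, hab, hac, hbc, hdb, hdc, had⟩ := h
  have hnad : ¬ G.Adj a d := fun h => hK a ha b hb c hc d hdU hab hac h hbc hdb.symm hdc.symm
  have hsub : U \ {a, b, c, d} ⊆ U := Finset.sdiff_subset
  have hlt : (U \ {a, b, c, d}).card < U.card :=
    Finset.card_lt_card ⟨hsub, fun h => by simpa using h ha⟩
  obtain ⟨f, hf⟩ := ih G _ hlt (hd.mono hsub) (hK.mono hsub)
  obtain ⟨a', ha'⟩ := hd.other ha hb hc hbc.ne hab hac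
  obtain ⟨d', hd'⟩ := hd.other hdU hb hc hbc.ne hdb hdc
  exact hf.extend_diamond hab.ne hac.ne had hbc.ne hdb.ne' hdc.ne' hnad ha'
    (hd.eq_of_adj hb ha hc hdU hac.ne had hdc.ne' hab.symm hbc hdb.symm)
    (hd.eq_of_adj hc ha hb hdU hab.ne had hdb.ne' hac.symm hbc.symm hdc.symm) hd'

/-- Joining a' and b' creates no K₄: its other two vertices would form a diamond with a' and b'. -/
theorem exists_coloring_of_triangle_of_not_adj (ih : ColoringHypothesis U) (hd : IsSubcubicOn G U)
    (hK : IsK4FreeOn G U) (hD : IsDiamondFreeOn G U) {a b c a' b' c' : V}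
    (haU : a ∈ U) (hbU : b ∈ U) (ha'U : a' ∈ U) (hb'U : b' ∈ U)
    (hab : G.Adj a b) (hac : G.Adj a c) (hbc : G.Adj b c)
    (haa' : G.Adj a a') (hbb' : G.Adj b b')
    (ha : ∀ w ∈ U, G.Adj a w → w = b ∨ w = c ∨ w = a')
    (hb : ∀ w ∈ U, G.Adj b w → w = a ∨ w = c ∨ w = b')
    (hc : ∀ w ∈ U, G.Adj c w → w = a ∨ w = b ∨ w = c')
    (hne : a' ≠ b') (hnadj : ¬ G.Adj a' b') : ∃ g, IsForestColoring G U g := by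
  classical
  have hsub : U \ {a, b, c} ⊆ U := Finset.sdiff_subset
  have hlt : (U \ {a, b, c}).card < U.card :=
    Finset.card_lt_card ⟨hsub, fun h => by simpa using h haU⟩
  obtain ⟨f, hf⟩ := ih (G ⊔ SimpleGraph.edge a' b') (U \ {a, b, c}) hlt
    (hd.sup_edge hsub hne haU hbU (by simp) (by simp) haa'.symm hbb'.symm)
    ((hK.sup_edge hne fun u hu w hw h1 h2 h3 h4 h5 =>
      hne (hD a' ha'U u hu w hw b' hb'U h1 h2 h5 h3 h4)).mono hsub)
  exact hf.extend_triangle hab.ne hac.ne hbc.ne hne hnadj ha hb hc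

theorem exists_coloring_of_triangle (ih : ColoringHypothesis U) (hd : IsSubcubicOn G U)
    (hK : IsK4FreeOn G U) (h3 : HasThreeNeighborsOn G U) (hD : IsDiamondFreeOn G U)
    (h : ¬ IsTriangleFreeOn G U) : ∃ g, IsForestColoring G U g := by
  classical
  simp only [IsTriangleFreeOn, not_forall, not_not] at h
  obtain ⟨a, haU, b, hbU, c, hcU, hab, hac, hbc⟩ := h
  obtain ⟨a', ha⟩ := hd.other haU hbU hcU hbc.ne hab hac
  obtain ⟨b', hb⟩ := hd.other hbU haU hcU hac.ne hab.symm hbc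
  obtain ⟨c', hc⟩ := hd.other hcU haU hbU hab.ne hac.symm hbc.symm
  obtain ⟨⟨-, -, ha'U⟩, ⟨-, -, haa'⟩, -, hba', hca'⟩ := h3.adj haU ha
  obtain ⟨⟨-, -, hb'U⟩, ⟨-, -, hbb'⟩, -, hab', hcb'⟩ := h3.adj hbU hb
  obtain ⟨⟨-, -, hc'U⟩, ⟨-, -, hcc'⟩, -, hac', hbc'⟩ := h3.adj hcU hc
  -- A common outer neighbor of a and b would give a second triangle on the edge ab.
  have n1 : a' ≠ b' := fun h => hca'
    (hD c hcU a haU b hbU a' ha'U hac.symm hbc.symm hab haa'.symm (h ▸ hbb'.symm))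
  have n2 : a' ≠ c' := fun h => hba'
    (hD b hbU a haU c hcU a' ha'U hab.symm hbc hac haa'.symm (h ▸ hcc'.symm))
  have n3 : b' ≠ c' := fun h => hab'
    (hD a haU b hbU c hcU b' hb'U hab hac hbc hbb'.symm (h ▸ hcc'.symm))
  by_cases e1 : G.Adj a' b'
  swap
  · exact exists_coloring_of_triangle_of_not_adj ih hd hK hD haU hbU ha'U hb'U hab hac hbc
      haa' hbb' ha hb hc n1 e1
  by_cases e2 : G.Adj a' c'
  swap
  · exact exists_coloring_of_triangle_of_not_adj ih hd hK hD haU hcU ha'U hc'U hac hab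
      hbc.symm haa' hcc' (fun w hw h => by have := ha w hw h; tauto) hc hb n2 e2
  by_cases e3 : G.Adj b' c'
  swap
  · exact exists_coloring_of_triangle_of_not_adj ih hd hK hD hbU hcU hb'U hc'U hbc hab.symm
      hac.symm hbb' hcc' (fun w hw h => by have := hb w hw h; tauto)
      (fun w hw h => by have := hc w hw h; tauto) ha n3 e3
  have hsub : U \ {a, b, c, a', b', c'} ⊆ U := Finset.sdiff_subset
  have hlt : (U \ {a, b, c, a', b', c'}).card < U.card :=
    Finset.card_lt_card ⟨hsub, fun h => by simpa using h haU⟩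
  obtain ⟨f, hf⟩ := ih G _ hlt (hd.mono hsub) (hK.mono hsub)
  refine hf.extend_prism ?_ haU hbU ha'U hb'U hc'U ha hb hc
    (hd.eq_of_adj ha'U haU hb'U hc'U hab' hac' n3 haa'.symm e1 e2)
    (hd.eq_of_adj hb'U hbU ha'U hc'U hba' hbc' n2 hbb'.symm e1.symm e3)
    (hd.eq_of_adj hc'U hcU ha'U hb'U hca' hcb' n1 hcc'.symm e2.symm e3.symm)
  have := hab.ne
  have := hac.ne
  have := hbc.ne
  have := haa'.ne
  have := hbb'.ne
  have := hcc'.ne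
  simp only [List.nodup_cons, List.mem_cons, List.not_mem_nil, or_false, not_or, not_false_eq_true,
    List.nodup_nil, and_true]
  tauto

/-- Deleting v, z and joining x to y and z₁ to z₂ keeps the graph subcubic, since each joined vertex
has lost a neighbor. It makes a K₄ only if x and y are both adjacent to both z₁ and z₂, and then the
deleted edge was part of a K₃,₃. -/
theorem exists_coloring_of_triangleFree (ih : ColoringHypothesis U) (hd : IsSubcubicOn G U)
    (hK : IsK4FreeOn G U) (h3 : HasThreeNeighborsOn G U) (hT : IsTriangleFreeOn G U)
    (hU : U.Nonempty) : ∃ g, IsForestColoring G U g := by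
  classical
  obtain ⟨v, hvU⟩ := hU
  obtain ⟨z, x, y, hv⟩ := hd v hvU
  obtain ⟨⟨hzU, hxU, hyU⟩, ⟨hvz, hvx, hvy⟩, hzx, hzy, hxy⟩ := h3.adj hvU hv
  obtain ⟨z₁, z₂, hz⟩ := hd.others hzU hvU hvz.symm
  obtain ⟨⟨-, hz₁U, hz₂U⟩, ⟨-, hzz₁, hzz₂⟩, hvz₁, hvz₂, hz₁₂⟩ := h3.adj hzU hz
  obtain ⟨x₁, x₂, hx⟩ := hd.others hxU hvU hvx.symm
  obtain ⟨y₁, y₂, hy⟩ := hd.others hyU hvU hvy.symm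
  have axy : ¬ G.Adj x y := hT v hvU x hxU y hyU hvx hvy
  have azz : ¬ G.Adj z₁ z₂ := hT z hzU z₁ hz₁U z₂ hz₂U hzz₁ hzz₂
  have axz : ¬ G.Adj x z := hT v hvU x hxU z hzU hvx hvz
  have ayz : ¬ G.Adj y z := hT v hvU y hyU z hzU hvy hvz
  have nx₁ : x ≠ z₁ := fun h => axz (h ▸ hzz₁.symm)
  have nx₂ : x ≠ z₂ := fun h => axz (h ▸ hzz₂.symm)
  have ny₁ : y ≠ z₁ := fun h => ayz (h ▸ hzz₁.symm)
  have ny₂ : y ≠ z₂ := fun h => ayz (h ▸ hzz₂.symm)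
  by_cases hbip : G.Adj x z₁ ∧ G.Adj x z₂ ∧ G.Adj y z₁ ∧ G.Adj y z₂
  · obtain ⟨hx₁, hx₂, hy₁, hy₂⟩ := hbip
    have hsub : U \ {v, z₁, z₂, z, x, y} ⊆ U := Finset.sdiff_subset
    have hlt : (U \ {v, z₁, z₂, z, x, y}).card < U.card :=
      Finset.card_lt_card ⟨hsub, fun h => by simpa using h hvU⟩
    obtain ⟨f, hf⟩ := ih G _ hlt (hd.mono hsub) (hK.mono hsub)
    refine hf.extend_completeBipartite ?_ hvU hz₁U hzU hxU hv
      (hd.eq_of_adj hz₁U hzU hxU hyU hzx hzy hxy hzz₁.symm hx₁.symm hy₁.symm)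
      (hd.eq_of_adj hz₂U hzU hxU hyU hzx hzy hxy hzz₂.symm hx₂.symm hy₂.symm) hz
      (hd.eq_of_adj hxU hvU hz₁U hz₂U hvz₁ hvz₂ hz₁₂ hvx.symm hx₁ hx₂)
      (hd.eq_of_adj hyU hvU hz₁U hz₂U hvz₁ hvz₂ hz₁₂ hvy.symm hy₁ hy₂)
    have := hvz.ne
    have := hvx.ne
    have := hvy.ne
    have := hzz₁.ne'
    have := hzz₂.ne'
    simp only [List.nodup_cons, List.mem_cons, List.not_mem_nil, or_false, not_or,
      not_false_eq_true, List.nodup_nil, and_true]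
    grind
  have hsub : U \ {v, z} ⊆ U := Finset.sdiff_subset
  have hlt : (U \ {v, z}).card < U.card :=
    Finset.card_lt_card ⟨hsub, fun h => by simpa using h hvU⟩
  have hmem : ∀ w ∈ U \ {v, z}, w ∈ U ∧ w ≠ v ∧ w ≠ z := fun w hw => by
    simpa [not_or] using hw
  have hd₁ : IsSubcubicOn (G ⊔ SimpleGraph.edge x y) (U \ {v}) :=
    hd.sup_edge Finset.sdiff_subset hxy hvU hvU (by simp) (by simp) hvx.symm hvy.symm
  have hK₁ : IsK4FreeOn (G ⊔ SimpleGraph.edge x y) U :=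
    hK.sup_edge hxy fun u hu w hw h1 h2 _ _ => hT x hxU u hu w hw h1 h2
  have hzU' : z ∈ U \ {v} := by simp [hzU, hvz.ne']
  -- A K₄ through the second new edge must contain xy as well, as the old graph has no triangle at
  -- z₁; this is the excluded bipartite case.
  have hK₂ : IsK4FreeOn (G ⊔ SimpleGraph.edge x y ⊔ SimpleGraph.edge z₁ z₂) U := by
    refine hK₁.sup_edge hz₁₂ fun u hu w hw h1 h2 h3 h4 h5 => ?_
    have hz₁' : ∀ w, (G ⊔ SimpleGraph.edge x y).Adj z₁ w → G.Adj z₁ w := fun w h =>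
      ((sup_edge_adj_iff hxy).1 h).resolve_right (by grind)
    have hz₂' : ∀ w, (G ⊔ SimpleGraph.edge x y).Adj z₂ w → G.Adj z₂ w := fun w h =>
      ((sup_edge_adj_iff hxy).1 h).resolve_right (by grind)
    replace h1 := hz₁' u h1
    replace h2 := hz₁' w h2
    replace h3 := hz₂' u h3
    replace h4 := hz₂' w h4
    rcases (sup_edge_adj_iff hxy).1 h5 with h | ⟨rfl, rfl⟩ | ⟨rfl, rfl⟩
    · exact hT z₁ hz₁U u hu w hw h1 h2 h
    · exact hbip ⟨h1.symm, h3.symm, h2.symm, h4.symm⟩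
    · exact hbip ⟨h2.symm, h4.symm, h1.symm, h3.symm⟩
  obtain ⟨f, hf⟩ := ih (G ⊔ SimpleGraph.edge x y ⊔ SimpleGraph.edge z₁ z₂) (U \ {v, z}) hlt
    (hd₁.sup_edge (Finset.sdiff_subset_sdiff subset_rfl (by simp)) hz₁₂ hzU' hzU' (by simp)
      (by simp) (.inl hzz₁.symm) (.inl hzz₂.symm)) (hK₂.mono hsub)
  have hfm : ∀ {w i}, i ∈ f w → w ∈ U ∧ w ≠ v ∧ w ≠ z := fun h => hmem _ (hf.mem h)
  have hfG : IsForestColoring G (U \ {v, z}) f :=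
    ⟨hf.card, hf.empty, fun i => (hf.forest i).mono_graph (le_sup_left.trans le_sup_left)⟩
  -- Each color is available at v alone, which subdivides xy, and at z alone, which subdivides z₁z₂.
  refine hfG.extend_adjacent_pair hvz.ne (fun i => ?_) (fun i => ?_) hv hx axz hy ayz
  · refine ((hf.forest i).mono_graph le_sup_left).subdivide hxy axy v fun u hu hvu => ?_
    exact (hv u (hfm hu).1 hvu).resolve_left (hfm hu).2.2
  · refine ((hf.forest i).mono_graph (sup_le_sup_right le_sup_left _)).subdivide hz₁₂ azz z
      fun u hu hzu => ?_
    exact (hz u (hfm hu).1 hzu).resolve_left (hfm hu).2.1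

theorem exists_isForestColoring_of_isK4FreeOn (hd : IsSubcubicOn G U) (hK : IsK4FreeOn G U) :
    ∃ f, IsForestColoring G U f := by
  induction hn : U.card using Nat.strong_induction_on generalizing G U with
  | _ n ih =>
    have ih' : ColoringHypothesis U := fun H W hW hHd hHK => ih W.card (hn ▸ hW) hHd hHK rfl
    by_cases h3 : HasThreeNeighborsOn G U
    swap
    · exact exists_coloring_of_two_neighbors ih' hd hK h3
    by_cases hD : IsDiamondFreeOn G U
    swap
    · exact exists_coloring_of_diamond ih' hd hK hD
    by_cases hT : IsTriangleFreeOn G U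
    swap
    · exact exists_coloring_of_triangle ih' hd hK h3 hD hT
    rcases U.eq_empty_or_nonempty with rfl | hU
    · exact exists_isForestColoring (f := fun _ => ∅) (by simp)
        fun i σ _ => ⟨1, fun u hu => by simp at hu⟩
    · exact exists_coloring_of_triangleFree ih' hd hK h3 hT hU

end SignedGraph

/-! ### Switching functions and balanced sets. -/

namespace SignedGraph

variable {V : Type*} {G : SimpleGraph V}

/-- One switches once at each vertex where s is -1; the induction is on a set containing these
vertices. -/
theorem switchingEquiv_of_potential [Finite V] (s : V → ℤˣ) {σ τ : Signature G}
    (h : ∀ u v (huv : G.Adj u v), τ ⟨s(u, v), huv⟩ = s u * s v * σ ⟨s(u, v), huv⟩) :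
    SwitchingEquiv σ τ := by
  classical
  cases nonempty_fintype V
  suffices H : ∀ (T : Finset V) (s : V → ℤˣ) (τ : Signature G), (∀ v ∉ T, s v = 1) →
      (∀ u v (huv : G.Adj u v), τ ⟨s(u, v), huv⟩ = s u * s v * σ ⟨s(u, v), huv⟩) →
      SwitchingEquiv σ τ from H Finset.univ s τ (by simp) h
  intro T
  induction T using Finset.induction_on with
  | empty =>
    intro s τ hs hτ
    have : τ = σ := by
      funext ⟨e, he⟩
      induction e with
      | _ u v => simpa [hs] using hτ u v he
    rw [this]
    exact Relation.ReflTransGen.refl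
  | insert a T ha ih =>
    intro s τ hs hτ
    rcases Int.units_eq_one_or (s a) with h1 | h1
    · refine ih s τ (fun v hv => ?_) hτ
      by_cases hva : v = a
      · rw [hva, h1]
      · exact hs v (by simp [hva, hv])
    · have hinv : τ = switchAt a (switchAt a τ) := by
        funext e
        by_cases hae : a ∈ (e : Sym2 V) <;> simp [switchAt, hae]
      refine Relation.ReflTransGen.tail (ih (Function.update s a 1) (switchAt a τ) ?_ ?_)
        ⟨a, hinv⟩
      · intro v hv
        by_cases hva : v = a
        · simp [hva]
        · rw [Function.update_of_ne hva]
          exact hs v (by simp [hva, hv])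
      · intro u v huv
        have huv' := huv.ne
        by_cases hu : u = a
        · subst hu
          simp [switchAt, hτ, h1, Function.update_of_ne huv'.symm]
        by_cases hv : v = a
        · subst hv
          simp [switchAt, hτ, h1, Function.update_of_ne huv']
        · simp [switchAt, hτ, Function.update_of_ne hu, Function.update_of_ne hv, Ne.symm hu,
            Ne.symm hv]

open scoped Classical in
/-- The sign of a pair of vertices, with value `1` on nonadjacent pairs. -/
noncomputable def sign (σ : Signature G) (u v : V) : ℤˣ :=
  if h : G.Adj u v then σ ⟨s(u, v), h⟩ else 1

theorem sign_of_adj (σ : Signature G) {u v : V} (h : G.Adj u v) : sign σ u v = σ ⟨s(u, v), h⟩ :=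
  dif_pos h

theorem sign_comm (σ : Signature G) (u v : V) : sign σ u v = sign σ v u := by
  by_cases h : G.Adj u v
  · rw [sign_of_adj σ h, sign_of_adj σ h.symm]
    congr 2
    exact Sym2.eq_swap
  · have h' : ¬ G.Adj v u := fun h' => h h'.symm
    simp [sign, h, h']

/-- `s` is a switching function which makes `σ` positive on the edges inside `X`. -/
def IsPotentialOn (σ : Signature G) (X : Set V) (s : V → ℤˣ) : Prop :=
  ∀ u ∈ X, ∀ v ∈ X, G.Adj u v → sign σ u v = s u * s v

theorem isBalancedSet_of_isPotentialOn [Finite V] {σ : Signature G} {X : Set V} {s : V → ℤˣ}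
    (h : IsPotentialOn σ X s) : IsBalancedSet σ X := by
  refine switchingEquiv_of_potential (fun u : X => s u) fun u v huv => ?_
  have h1 := h u u.2 v v.2 huv
  rw [sign_of_adj σ (show G.Adj u v from huv)] at h1
  have h2 : σ.restrict X ⟨s(u, v), huv⟩ = s u * s v := h1
  rw [h2]
  simp

/-! ### Components isomorphic to K₄. -/

variable {U : Finset V} {σ : Signature G}

/-- A K₄ uses up the degrees of its vertices, so potentials on it and on the rest can be chosen
independently. With abc and abd positive, classes that avoid having c and d together with a or b are
balanced. -/
theorem exists_coloring_of_insert_K4 [DecidableEq V] {a b c d : V}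
    {f : V → Finset (Fin 5)} (hd : IsSubcubicOn G U)
    (haU : a ∈ U) (hbU : b ∈ U) (hcU : c ∈ U) (hdU : d ∈ U)
    (hab : G.Adj a b) (hac : G.Adj a c) (had : G.Adj a d) (hbc : G.Adj b c) (hbd : G.Adj b d)
    (hcd : G.Adj c d) (habc : sign σ b c = sign σ a b * sign σ a c)
    (habd : sign σ b d = sign σ a b * sign σ a d)
    (hf3 : ∀ v ∈ U \ {a, b, c, d}, (f v).card = 3) (hf0 : ∀ v ∉ U \ {a, b, c, d}, f v = ∅)
    (hfσ : ∀ i, ∃ s, IsPotentialOn σ {v | i ∈ f v} s) :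
    ∃ g : V → Finset (Fin 5), (∀ v ∈ U, (g v).card = 3) ∧ (∀ v ∉ U, g v = ∅) ∧
      ∀ i, ∃ s, IsPotentialOn σ {v | i ∈ g v} s := by
  have hna := hd.eq_of_adj haU hbU hcU hdU hbc.ne hbd.ne hcd.ne hab hac had
  have hnb := hd.eq_of_adj hbU haU hcU hdU hac.ne had.ne hcd.ne hab.symm hbc hbd
  have hnc := hd.eq_of_adj hcU haU hbU hdU hab.ne had.ne hbd.ne hac.symm hbc.symm hcd
  have hnd := hd.eq_of_adj hdU haU hbU hcU hab.ne hac.ne hbc.ne had.symm hbd.symm hcd.symm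
  have nab := hab.ne
  have nac := hac.ne
  have nad := had.ne
  have nbc := hbc.ne
  have nbd := hbd.ne
  have ncd := hcd.ne
  have hfU : ∀ {v i}, i ∈ f v → v ∈ U ∧ v ≠ a ∧ v ≠ b ∧ v ≠ c ∧ v ≠ d := by
    intro v i hv
    by_contra hcon
    have : v ∉ U \ {a, b, c, d} := by simpa [not_or] using hcon
    simp [hf0 v this] at hv
  have hnadj : ∀ {u v i}, i ∈ f v → (u = a ∨ u = b ∨ u = c ∨ u = d) → ¬ G.Adj u v := by
    intro u v i hv hu huv
    obtain ⟨hvU, h1, h2, h3, h4⟩ := hfU hv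
    rcases hu with rfl | rfl | rfl | rfl
    · have := hna v hvU huv
      tauto
    · have := hnb v hvU huv
      tauto
    · have := hnc v hvU huv
      tauto
    · have := hnd v hvU huv
      tauto
  let g : V → Finset (Fin 5) := fun v => if v = a then {0, 1, 2} else if v = b then {0, 1, 2} else
    if v = c then {0, 1, 4} else if v = d then {2, 3, 4} else f v
  have glue : ∀ i (t : V → ℤˣ), IsPotentialOn σ
      {v | i ∈ g v ∧ (v = a ∨ v = b ∨ v = c ∨ v = d)} t →
      ∃ s, IsPotentialOn σ {v | i ∈ g v} s := by
    intro i t ht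
    obtain ⟨s, hs⟩ := hfσ i
    have hg : ∀ v, i ∈ g v → ¬ (v = a ∨ v = b ∨ v = c ∨ v = d) → i ∈ f v := by
      intro v hv hS
      simp only [not_or] at hS
      simpa [g, hS.1, hS.2.1, hS.2.2.1, hS.2.2.2] using hv
    refine ⟨fun v => if v = a ∨ v = b ∨ v = c ∨ v = d then t v else s v, ?_⟩
    intro u hu v hv huv
    by_cases hu' : u = a ∨ u = b ∨ u = c ∨ u = d
    · by_cases hv' : v = a ∨ v = b ∨ v = c ∨ v = d
      · simp only [hu', hv', if_true]
        exact ht u ⟨hu, hu'⟩ v ⟨hv, hv'⟩ huv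
      · exact absurd huv (hnadj (hg v hv hv') hu')
    · by_cases hv' : v = a ∨ v = b ∨ v = c ∨ v = d
      · exact absurd huv.symm (hnadj (hg u hu hu') hv')
      · simp only [hu', hv', if_false]
        exact hs u (hg u hu hu') v (hg v hv hv') huv
  refine ⟨g, fun v hv => ?_, fun v hv => ?_, fun i => ?_⟩
  · by_cases hS : v = a ∨ v = b ∨ v = c ∨ v = d
    · rcases hS with rfl | rfl | rfl | rfl
      · simp [g]
      · simp [g, nab.symm]
      · simp [g, nac.symm, nbc.symm]
      · simp [g, nad.symm, nbd.symm, ncd.symm]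
    · simp only [not_or] at hS
      simpa [g, hS] using hf3 v (by simp [hv, hS])
  · have : v ≠ a ∧ v ≠ b ∧ v ≠ c ∧ v ≠ d := by
      refine ⟨?_, ?_, ?_, ?_⟩ <;> (rintro rfl; contradiction)
    simpa [g, this] using hf0 v (by simp [hv])
  · by_cases hi : i = 4
    -- Color 4 occurs on the single edge cd only.
    · refine glue i (fun v => if v = d then sign σ c d else 1) ?_
      subst hi
      rintro u ⟨hu, rfl | rfl | rfl | rfl⟩ v ⟨hv, rfl | rfl | rfl | rfl⟩ huv <;>
        simp [g, ncd, nab.symm, nac.symm, nad.symm, nbc.symm, nbd.symm,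
          ncd.symm] at hu hv huv ⊢
      exact sign_comm σ _ _
    -- Inside this K₄ the remaining classes lie in abc or abd; the signs of the edges at a are a
    -- potential on both.
    · refine glue i (fun v => if v = a then 1 else sign σ a v) ?_
      have hcd' : ¬ (i ∈ g c ∧ i ∈ g d) := by
        simp only [g, nac.symm, nbc.symm, nad.symm, nbd.symm, ncd.symm, if_true, if_false]
        revert hi
        revert i
        decide
      rintro u ⟨hu, rfl | rfl | rfl | rfl⟩ v ⟨hv, rfl | rfl | rfl | rfl⟩ huv <;>
        first
        | exact absurd huv G.irrefl
        | simp only [nab.symm, nac.symm, nad.symm, if_true, if_false, one_mul, mul_one]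
      · exact sign_comm σ _ _
      · exact habc
      · exact habd
      · exact sign_comm σ _ _
      · rw [sign_comm, habc, mul_comm]
      · exact absurd ⟨hu, hv⟩ hcd'
      · exact sign_comm σ _ _
      · rw [sign_comm, habd, mul_comm]
      · exact absurd ⟨hv, hu⟩ hcd'

/-- `abcd` is a copy of `K₄` in which every triangle is negative. -/
structure IsNegK4 (σ : Signature G) (a b c d : V) : Prop where
  ab : G.Adj a b
  ac : G.Adj a c
  ad : G.Adj a d
  bc : G.Adj b c
  bd : G.Adj b d
  cd : G.Adj c d
  abc : sign σ b c = -(sign σ a b * sign σ a c)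
  abd : sign σ b d = -(sign σ a b * sign σ a d)
  acd : sign σ c d = -(sign σ a c * sign σ a d)

/-- A signed `K₄` with a positive triangle has two of them. -/
theorem exists_two_positive_triangles : ∀ ab ac ad bc bd cd : ℤˣ,
    (bc = -(ab * ac) ∧ bd = -(ab * ad) ∧ cd = -(ac * ad)) ∨
    (bc = ab * ac ∧ bd = ab * ad) ∨ (bc = ac * ab ∧ cd = ac * ad) ∨ (bd = ad * ab ∧ cd = ad * ac) ∨
    (ac = bc * ab ∧ cd = bc * bd) ∨ (ad = bd * ab ∧ cd = bd * bc) ∨ (ad = cd * ac ∧ bd = cd * bc) := by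
  -- Each edge lies in two triangles, so the product of the four triangle signs is positive and
  -- positive triangles come in pairs.
  decide

theorem exists_balanced_coloring (hd : IsSubcubicOn G U)
    (hneg : ∀ a ∈ U, ∀ b ∈ U, ∀ c ∈ U, ∀ d ∈ U, ¬ IsNegK4 σ a b c d) :
    ∃ g : V → Finset (Fin 5), (∀ v ∈ U, (g v).card = 3) ∧ (∀ v ∉ U, g v = ∅) ∧
      ∀ i, ∃ s, IsPotentialOn σ {v | i ∈ g v} s := by
  classical
  induction hn : U.card using Nat.strong_induction_on generalizing U with
  | _ n ih =>
    by_cases hK : IsK4FreeOn G U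
    · obtain ⟨f, hf⟩ := exists_isForestColoring_of_isK4FreeOn hd hK
      -- The forest property holds for all symmetric sign functions, in particular for the given
      -- signature.
      exact ⟨f, hf.card, hf.empty, fun i => hf.forest i (sign σ) (sign_comm σ)⟩
    simp only [IsK4FreeOn, not_forall, not_not] at hK
    obtain ⟨a, ha, b, hb, c, hc, d, hdU, ab, ac, ad, bc, bd, cd⟩ := hK
    have hsub : U \ {a, b, c, d} ⊆ U := Finset.sdiff_subset
    have hlt : (U \ {a, b, c, d}).card < n :=
      hn ▸ Finset.card_lt_card ⟨hsub, fun h => by simpa using h ha⟩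
    obtain ⟨f, hf3, hf0, hfσ⟩ := ih _ hlt (hd.mono hsub)
      (fun a ha b hb c hc d hd => hneg a (hsub ha) b (hsub hb) c (hsub hc) d (hsub hd)) rfl
    have key : ∀ {p q r t : V}, ({p, q, r, t} : Finset V) = {a, b, c, d} → p ∈ U → q ∈ U →
        r ∈ U → t ∈ U → G.Adj p q → G.Adj p r → G.Adj p t → G.Adj q r → G.Adj q t → G.Adj r t →
        sign σ q r = sign σ p q * sign σ p r → sign σ q t = sign σ p q * sign σ p t →
        ∃ g : V → Finset (Fin 5), (∀ v ∈ U, (g v).card = 3) ∧ (∀ v ∉ U, g v = ∅) ∧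
          ∀ i, ∃ s, IsPotentialOn σ {v | i ∈ g v} s := by
      intro p q r t hS hp hq hr ht pq pr pt qr qt rt h1 h2
      rw [← hS] at hf3 hf0
      exact exists_coloring_of_insert_K4 hd hp hq hr ht pq pr pt qr qt rt h1 h2 hf3 hf0 hfσ
    have eba := sign_comm σ b a
    have eca := sign_comm σ c a
    have ecb := sign_comm σ c b
    have eda := sign_comm σ d a
    have edb := sign_comm σ d b
    have edc := sign_comm σ d c
    rcases exists_two_positive_triangles (sign σ a b) (sign σ a c) (sign σ a d) (sign σ b c)
      (sign σ b d) (sign σ c d) with ⟨h1, h2, h3⟩ | ⟨h1, h2⟩ | ⟨h1, h2⟩ | ⟨h1, h2⟩ | ⟨h1, h2⟩ |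
        ⟨h1, h2⟩ | ⟨h1, h2⟩
    · exact absurd ⟨ab, ac, ad, bc, bd, cd, h1, h2, h3⟩ (hneg a ha b hb c hc d hdU)
    · exact key rfl ha hb hc hdU ab ac ad bc bd cd h1 h2
    · exact key (p := a) (q := c) (r := b) (t := d) (by ext; simp; tauto) ha hc hb hdU ac ab ad
        bc.symm cd bd (by rw [ecb, h1]) h2
    · exact key (p := a) (q := d) (r := b) (t := c) (by ext; simp; tauto) ha hdU hb hc ad ab ac
        bd.symm cd.symm bc (by rw [edb, h1]) (by rw [edc, h2])
    · exact key (p := b) (q := c) (r := a) (t := d) (by ext; simp; tauto) hb hc ha hdU bc ab.symm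
        bd ac.symm cd ad (by rw [eca, eba, h1]) h2
    · exact key (p := b) (q := d) (r := a) (t := c) (by ext; simp; tauto) hb hdU ha hc bd ab.symm
        bc ad.symm cd.symm ac (by rw [eda, eba, h1]) (by rw [edc, h2])
    · exact key (p := c) (q := d) (r := a) (t := b) (by ext; simp; tauto) hc hdU ha hb cd ac.symm
        bc.symm ad.symm bd.symm ab (by rw [eda, eca, h1]) (by rw [edb, ecb, h2])

theorem IsNegK4.switchingIsomorphic [Finite V] {a b c d : V} (h : IsNegK4 σ a b c d)
    {X : Set V} (hX : X = {a, b, c, d}) : SwitchingIsomorphic (σ.restrict X) negK4 := by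
  classical
  have nab := h.ab.ne
  have nac := h.ac.ne
  have nad := h.ad.ne
  have nbc := h.bc.ne
  have nbd := h.bd.ne
  have ncd := h.cd.ne
  have hmem : ∀ v, v ∈ X ↔ v = a ∨ v = b ∨ v = c ∨ v = d := by
    intro v
    simp [hX]
  let e₀ : Fin 4 → X := ![⟨a, by simp [hX]⟩, ⟨b, by simp [hX]⟩, ⟨c, by simp [hX]⟩,
    ⟨d, by simp [hX]⟩]
  have hbij : Function.Bijective e₀ := by
    constructor
    · intro i j hij
      fin_cases i <;> fin_cases j <;>
        simp [e₀, nab, nac, nad, nbc, nbd, ncd, nab.symm, nac.symm, nad.symm, nbc.symm, nbd.symm,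
          ncd.symm] at hij ⊢
    · rintro ⟨v, hv⟩
      rcases (hmem v).1 hv with rfl | rfl | rfl | rfl
      · exact ⟨0, rfl⟩
      · exact ⟨1, rfl⟩
      · exact ⟨2, rfl⟩
      · exact ⟨3, rfl⟩
  have hadj : ∀ u ∈ X, ∀ v ∈ X, u ≠ v → G.Adj u v := by
    intro u hu v hv huv
    have := h.ab
    have := h.ac
    have := h.ad
    have := h.bc
    have := h.bd
    have := h.cd
    rcases (hmem u).1 hu with rfl | rfl | rfl | rfl <;>
      rcases (hmem v).1 hv with rfl | rfl | rfl | rfl <;>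
      first | exact absurd rfl huv | assumption | (apply SimpleGraph.Adj.symm; assumption)
  let φ : G.induce X ≃g (⊤ : SimpleGraph (Fin 4)) :=
    { toEquiv := (Equiv.ofBijective e₀ hbij).symm
      map_rel_iff' := by
        intro u v
        simp only [SimpleGraph.top_adj, ne_eq, EmbeddingLike.apply_eq_iff_eq]
        constructor
        · intro huv
          exact hadj u u.2 v v.2 fun h => huv (Subtype.ext h)
        · rintro huv rfl
          exact huv.ne rfl }
  -- This switching makes the edges at a negative; the negative triangles at a then force the other
  -- three edges to be negative.
  refine ⟨φ, switchingEquiv_of_potential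
    (fun u : X => if (u : V) = a then 1 else -sign σ a u) fun u v huv => ?_⟩
  have hσ : σ.restrict X ⟨s(u, v), huv⟩ = sign σ u v := (sign_of_adj σ (u := u) (v := v) huv).symm
  rw [hσ]
  change (-1 : ℤˣ) = _
  have huv' : (u : V) ≠ v := fun h => huv.ne (Subtype.ext h)
  have sbc := h.abc
  have sbd := h.abd
  have scd := h.acd
  have sba := sign_comm σ b a
  have sca := sign_comm σ c a
  have sda := sign_comm σ d a
  have scb : sign σ c b = -(sign σ a c * sign σ a b) := by rw [sign_comm, sbc, mul_comm]
  have sdb : sign σ d b = -(sign σ a d * sign σ a b) := by rw [sign_comm, sbd, mul_comm]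
  have sdc : sign σ d c = -(sign σ a d * sign σ a c) := by rw [sign_comm, scd, mul_comm]
  rcases u with ⟨u, hu⟩
  rcases v with ⟨v, hv⟩
  simp only at huv' ⊢
  rcases (hmem u).1 hu with rfl | rfl | rfl | rfl <;>
    rcases (hmem v).1 hv with rfl | rfl | rfl | rfl <;>
    first
    | exact absurd rfl huv'
    | simp [nab.symm, nac.symm, nad.symm, sbc, sbd, scd, sba, sca, sda, scb, sdb, sdc]

theorem isSubcubicOn_univ [Fintype V] [DecidableRel G.Adj] (h : ∀ v, G.degree v ≤ 3) :
    IsSubcubicOn G Finset.univ := by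
  classical
  intro v _
  have hv := h v
  rw [← G.card_neighborFinset_eq_degree] at hv
  have hN : ∀ w, G.Adj v w ↔ w ∈ G.neighborFinset v := fun w => by simp
  simp only [hN]
  have h4 : (G.neighborFinset v).card = 0 ∨ (G.neighborFinset v).card = 1 ∨
    (G.neighborFinset v).card = 2 ∨ (G.neighborFinset v).card = 3 := by omega
  rcases h4 with h | h | h | h
  · rw [Finset.card_eq_zero] at h
    exact ⟨v, v, v, by simp [h]⟩
  · obtain ⟨a, h⟩ := Finset.card_eq_one.1 h
    exact ⟨a, a, a, by simp [h]⟩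
  · obtain ⟨a, b, -, h⟩ := Finset.card_eq_two.1 h
    exact ⟨a, b, b, by simp [h]⟩
  · obtain ⟨a, b, c, -, -, -, h⟩ := Finset.card_eq_three.1 h
    exact ⟨a, b, c, by simp [h]⟩

/-- Each of the four vertices already has three neighbors among the others, so no walk leaves the
set. -/
theorem IsNegK4.supp_eq [Fintype V] {a b c d : V} (h : IsNegK4 σ a b c d)
    (hd : IsSubcubicOn G Finset.univ) : (G.connectedComponentMk a).supp = {a, b, c, d} := by
  have hu : ∀ v : V, v ∈ Finset.univ := Finset.mem_univ
  have hna := hd.eq_of_adj (hu a) (hu b) (hu c) (hu d) h.bc.ne h.bd.ne h.cd.ne h.ab h.ac h.ad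
  have hnb := hd.eq_of_adj (hu b) (hu a) (hu c) (hu d) h.ac.ne h.ad.ne h.cd.ne h.ab.symm h.bc h.bd
  have hnc := hd.eq_of_adj (hu c) (hu a) (hu b) (hu d) h.ab.ne h.ad.ne h.bd.ne h.ac.symm h.bc.symm
    h.cd
  have hnd := hd.eq_of_adj (hu d) (hu a) (hu b) (hu c) h.ab.ne h.ac.ne h.bc.ne h.ad.symm h.bd.symm
    h.cd.symm
  have hclosed : ∀ {u v : V}, G.Adj u v → u ∈ ({a, b, c, d} : Set V) →
      v ∈ ({a, b, c, d} : Set V) := by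
    intro u v huv hmem
    simp only [Set.mem_insert_iff, Set.mem_singleton_iff] at hmem ⊢
    rcases hmem with rfl | rfl | rfl | rfl
    · have := hna v (hu v) huv
      tauto
    · have := hnb v (hu v) huv
      tauto
    · have := hnc v (hu v) huv
      tauto
    · have := hnd v (hu v) huv
      tauto
  ext v
  rw [SimpleGraph.ConnectedComponent.mem_supp_iff, SimpleGraph.ConnectedComponent.eq]
  constructor
  · intro hv
    have hw : ∀ {x y : V}, G.Walk x y → x ∈ ({a, b, c, d} : Set V) →
        y ∈ ({a, b, c, d} : Set V) := by
      intro x y p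
      induction p with
      | nil => exact id
      | cons hxy _ ih => exact fun hx => ih (hclosed hxy hx)
    obtain ⟨p⟩ := hv.symm
    exact hw p (by simp)
  · rintro (rfl | rfl | rfl | rfl)
    · exact .rfl
    · exact h.ab.symm.reachable
    · exact h.ac.symm.reachable
    · exact h.ad.symm.reachable

theorem fractionalBalancedChromaticNumber_le {p q : ℕ} (hq : 1 ≤ q) (hqp : q ≤ p)
    (h : AdmitsColoring σ p q) : fractionalBalancedChromaticNumber σ ≤ p / q := by
  refine csInf_le ⟨0, ?_⟩ ⟨p, q, hq, hqp, h, rfl⟩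
  rintro x ⟨p, q, -, -, -, rfl⟩
  positivity

end SignedGraph

theorem theorem1p4 {V : Type*} [Fintype V] (G : SimpleGraph V) [DecidableRel G.Adj]
    (σ : SignedGraph.Signature G)
    (hsubcubic : ∀ v : V, G.degree v ≤ 3)
    (hK4 : ∀ c : G.ConnectedComponent,
      ¬ SignedGraph.SwitchingIsomorphic (σ.restrict c.supp) SignedGraph.negK4) :
    SignedGraph.AdmitsColoring σ 5 3 ∧
      SignedGraph.fractionalBalancedChromaticNumber σ ≤ 5 / 3 := by
  have hd := SignedGraph.isSubcubicOn_univ hsubcubic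
  obtain ⟨g, hg3, -, hgσ⟩ := SignedGraph.exists_balanced_coloring (σ := σ) hd
    fun a _ b _ c _ d _ h => hK4 _ (h.switchingIsomorphic (h.supp_eq hd))
  have h : SignedGraph.AdmitsColoring σ 5 3 := by
    refine ⟨g, fun v => hg3 v (Finset.mem_univ v), fun i => ?_⟩
    obtain ⟨s, hs⟩ := hgσ i
    exact SignedGraph.isBalancedSet_of_isPotentialOn hs
  exact ⟨h, by simpa using
    SignedGraph.fractionalBalancedChromaticNumber_le (by norm_num) (by norm_num) h⟩
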